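/- Let $(M,g)$ be a connected, paracompact, Hausdorff smooth Riemannian manifold of dimension $n\ge 1$, possibly with boundary, and let $G$ be a unimodular Lie group (Hausdorff, second countable) acting smoothly on $M$ by isometries. Put $$M_0=\{x\in M\setminus\partial M:\ G\cdot x\neq\{x\}\}.$$ Let $\tilde\Sigma\hookrightarrow M$ be a connected, injectively immersed, smooth one-dimensional submanifold (possibly with boundary) which is a section of the action: for every $x\in\Sigma:=\tilde\Sigma\cap M_0$ there is an orthogonal direct sum decomposition $$T_xM=T_x\tilde\Sigma\oplus T_x(G\cdot x).$$ Assume that $M_0$ is open in $M$, that $\Sigma$ is a (nonempty) open connected subset of the manifold $\tilde\Sigma$, that $M_0=G\cdot\Sigma$, and that for $x\in\Sigma$ the orbit $G\cdot x$ has finite positive $(n-1)$-dimensional Riemannian measure $A(x)$, where $A:\Sigma\to(0,\infty)$ is smooth. Let $\gamma:D\to\Sigma$ be a parametrization of $\Sigma$ by arclength on an open interval $D\subset\mathbb R$, write $A(t)=A(\gamma(t))$, let $r_0\in D$, and assume that $$J(r)=\int_{r_0}^r\frac{dt}{A(t)}$$ is a $C^2$ diffeomorphism of $D$ onto all of $\mathbb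 R$. Let $f:M\times\mathbb R\to\mathbb R$ be continuous with $f(g\cdot x,y)=f(x,y)$ for all $g\in G$, $x\in M$, $y\in\mathbb R$, and $f\ge 0$. A $C^2$ maximal radial solution of $$\Delta_M u+f(x,u(x))=0,\qquad \Delta_M u=\frac1{\sqrt{\bar g}}\sum_k\partial_k\Big(\sum_i g^{ik}\sqrt{\bar g}\,\partial_i u\Big),\quad \bar g=\det(g_{ij}),$$ is a $G$-invariant function $u\in C^2(M_0)$ that satisfies the equation at every point of $M_0$. Then every nonnegative $C^2$ maximal radial solution of this equation is constant on $M_0$. In particular, if $f>0$ on $M\times\mathbb R$, the equation has no nonnegative $C^2$ maximal radial solution. -/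

import Mathlib

open Bundle
open scoped Manifold ContDiff ENNReal

noncomputable section

/-! ### The Laplace–Beltrami operator in coordinates -/

section LaplaceBeltrami

variable {n : ℕ} {H : Type*} [TopologicalSpace H]
  (I : ModelWithCorners ℝ (EuclideanSpace ℝ (Fin n)) H)
  {M : Type*} [TopologicalSpace M] [ChartedSpace H M]

/-- The coordinate vector field `∂/∂xᵢ` of the preferred chart at `p`, at the point of `M` with
coordinates `y`. -/
def coordVector (p : M) (y : EuclideanSpace ℝ (Fin n)) (i : Fin n) :
    TangentSpace I ((extChartAt I p).symm y) :=
  mfderivWithin 𝓘(ℝ, EuclideanSpace ℝ (Fin n)) I (extChartAt I p).symm (Set.range I) y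
    (EuclideanSpace.single i (1 : ℝ) : EuclideanSpace ℝ (Fin n))

/-- The partial derivative `∂h/∂xᵢ` at `y` of a function of the coordinates, which range over
(an open piece of) `range I`. -/
def coordDeriv (h : EuclideanSpace ℝ (Fin n) → ℝ) (y : EuclideanSpace ℝ (Fin n)) (i : Fin n) :
    ℝ :=
  fderivWithin ℝ h (Set.range I) y (EuclideanSpace.single i (1 : ℝ))

variable [RiemannianBundle (fun x : M => TangentSpace I x)]

/-- The matrix `(g_{ij})` of the Riemannian metric in the preferred chart at `p`. -/
def metricMatrix (p : M) (y : EuclideanSpace ℝ (Fin n)) : Matrix (Fin n) (Fin n) ℝ :=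
  Matrix.of fun i j => inner ℝ (coordVector I p y i) (coordVector I p y j)

/-- The Laplace–Beltrami operator (divergence of the gradient)
`Δ u = (1/√ḡ) ∑ₖ ∂ₖ (∑ᵢ g^{ik} √ḡ ∂ᵢ u)`, where `ḡ = det (g_{ij})`, evaluated at `p` in the
preferred chart at `p`. -/
def laplaceBeltrami (u : M → ℝ) (p : M) : ℝ :=
  (1 / √(metricMatrix I p (extChartAt I p p)).det) *
    ∑ k, coordDeriv I
      (fun y => ∑ i, (metricMatrix I p y)⁻¹ i k * √(metricMatrix I p y).det *
        coordDeriv I (u ∘ (extChartAt I p).symm) y i)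
      (extChartAt I p p) k

end LaplaceBeltrami

/-! ### The Riemannian measure of an immersed submanifold -/

section Volume

variable {E : Type*} [NormedAddCommGroup E] [NormedSpace ℝ E] {H : Type*} [TopologicalSpace H]
  (I : ModelWithCorners ℝ E H) {M : Type*} [TopologicalSpace M] [ChartedSpace H M]

/-- `ψ` restricted to the open set `U ⊆ ℝᵏ` is a smooth injective immersion into `M` with image
in `S`. -/
structure IsParametrizedPiece {k : ℕ} (ψ : EuclideanSpace ℝ (Fin k) → M)
    (U : Set (EuclideanSpace ℝ (Fin k))) (S : Set M) : Prop where
  isOpen : IsOpen U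
  contMDiffOn : ContMDiffOn 𝓘(ℝ, EuclideanSpace ℝ (Fin k)) I ∞ ψ U
  injOn : Set.InjOn ψ U
  immersion : ∀ v ∈ U,
    Function.Injective (mfderiv 𝓘(ℝ, EuclideanSpace ℝ (Fin k)) I ψ v)
  mapsTo : Set.MapsTo ψ U S

variable [RiemannianBundle (fun x : M => TangentSpace I x)]

/-- The Gram matrix `⟨∂ᵢψ, ∂ⱼψ⟩` of a parametrization. -/
def gramMatrix {k : ℕ} (ψ : EuclideanSpace ℝ (Fin k) → M) (v : EuclideanSpace ℝ (Fin k)) :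
    Matrix (Fin k) (Fin k) ℝ :=
  Matrix.of fun i j => inner ℝ
    (mfderiv 𝓘(ℝ, EuclideanSpace ℝ (Fin k)) I ψ v
      (EuclideanSpace.single i (1 : ℝ) : EuclideanSpace ℝ (Fin k)))
    (mfderiv 𝓘(ℝ, EuclideanSpace ℝ (Fin k)) I ψ v
      (EuclideanSpace.single j (1 : ℝ) : EuclideanSpace ℝ (Fin k)))

/-- The `k`-dimensional Riemannian volume `∫_U √det ⟨∂ᵢψ, ∂ⱼψ⟩ dv` of a parametrized piece. -/
def pieceVolume {k : ℕ} (ψ : EuclideanSpace ℝ (Fin k) → M)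
    (U : Set (EuclideanSpace ℝ (Fin k))) : ℝ≥0∞ :=
  ∫⁻ v in U, ENNReal.ofReal (√(gramMatrix I ψ v).det)

/-- The `k`-dimensional Riemannian measure of a `k`-dimensional (immersed) submanifold `S` of `M`:
the supremum of the total volumes of finite families of pairwise disjoint parametrized pieces
of `S`. (Finitely many disjoint coordinate domains exhaust `S` up to arbitrarily small volume if
the volume is finite, and have arbitrarily large volume if it is infinite.) -/
def riemannianVolume (k : ℕ) (S : Set M) : ℝ≥0∞ :=
  ⨆ (N : ℕ) (ψ : Fin N → EuclideanSpace ℝ (Fin k) → M)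
    (U : Fin N → Set (EuclideanSpace ℝ (Fin k)))
    (_ : ∀ i, IsParametrizedPiece I (ψ i) (U i) S)
    (_ : Pairwise fun i j => Disjoint (ψ i '' U i) (ψ j '' U j)),
    ∑ i, pieceVolume I (ψ i) (U i)

end Volume

/-! ### Isometric actions and their sections -/

section Action

variable {EG : Type*} [NormedAddCommGroup EG] [NormedSpace ℝ EG]
  {HG : Type*} [TopologicalSpace HG] (IG : ModelWithCorners ℝ EG HG)
  (G : Type*) [TopologicalSpace G] [ChartedSpace HG G] [Group G]
  {E : Type*} [NormedAddCommGroup E] [NormedSpace ℝ E] {H : Type*} [TopologicalSpace H]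
  (I : ModelWithCorners ℝ E H)
  (M : Type*) [TopologicalSpace M] [ChartedSpace H M] [MulAction G M]

/-- `G` is unimodular: every left Haar measure is right invariant. -/
def IsUnimodularGroup [MeasurableSpace G] : Prop :=
  ∀ μ : MeasureTheory.Measure G, μ.IsHaarMeasure → μ.IsMulRightInvariant

/-- `M₀`: the interior points of `M` that are not fixed by the whole group, `G • x ≠ {x}`. -/
def nonFixedInterior : Set M :=
  {x | MulAction.orbit G x ≠ {x}} ∩ I.interior M

variable {M}

/-- The tangent space at `x` of the orbit of `x`: the range of the differential at the identity of
the orbit map `g ↦ g • x`. (The differential has values in the tangent space at `1 • x = x`, whence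
the transport along `one_smul G x : 1 • x = x`.) -/
def orbitTangentSpace (x : M) : Submodule ℝ (TangentSpace I x) :=
  one_smul G x ▸ LinearMap.range (mfderiv IG I (fun g : G => g • x) 1).toLinearMap

variable [RiemannianBundle (fun x : M => TangentSpace I x)]

variable (M) in
/-- `G` acts smoothly on `M` by isometries of the Riemannian metric. -/
structure IsIsometricAction : Prop where
  smooth : ContMDiff (IG.prod I) I ∞ (fun p : G × M => p.1 • p.2)
  isometry : ∀ (g : G) (x : M) (v w : TangentSpace I x),
    inner ℝ (mfderiv I I (fun y : M => g • y) x v) (mfderiv I I (fun y : M => g • y) x w) =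
      inner ℝ v w

/-- The Riemannian measure `A(x)` of the orbit of `x`, of dimension `k`. -/
def orbitVolume (k : ℕ) (x : M) : ℝ≥0∞ :=
  riemannianVolume I k (MulAction.orbit G x)

variable {HS : Type*} [TopologicalSpace HS]
  (IS : ModelWithCorners ℝ (EuclideanSpace ℝ (Fin 1)) HS)
  {S : Type*} [TopologicalSpace S] [ChartedSpace HS S]

/-- The part `Σ` of the section `ι : S → M` that lies in `M₀`, as a subset of `S`. -/
def regularPart (ι : S → M) : Set S :=
  ι ⁻¹' nonFixedInterior G I M

/-- `ι : S → M` is an injectively immersed connected one-dimensional submanifold (possibly with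
boundary) which is a section of a polar action of `G`: at its points in `M₀`, the tangent space of
`M` is the orthogonal direct sum of the tangent spaces of the submanifold and of the orbit. -/
structure IsPolarSection (ι : S → M) : Prop where
  isometricAction : IsIsometricAction IG G I M
  connected : ConnectedSpace S
  isManifold : IsManifold IS ∞ S
  smooth : ContMDiff IS I ∞ ι
  injective : Function.Injective ι
  immersion : ∀ s, Function.Injective (mfderiv IS I ι s)
  isCompl : ∀ s ∈ regularPart G I ι,
    IsCompl (LinearMap.range (mfderiv IS I ι s).toLinearMap) (orbitTangentSpace IG G I (ι s))
  orthogonal : ∀ s ∈ regularPart G I ι, ∀ v ∈ LinearMap.range (mfderiv IS I ι s).toLinearMap,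
    ∀ w ∈ orbitTangentSpace IG G I (ι s), inner ℝ v w = 0

/-- The regularity conditions on a section: `M₀` is open in `M` and is swept out by the orbits
through `Σ`, which is an open connected submanifold of the section; the orbits through `Σ`,
which have dimension `k`, have finite Riemannian measure, and this measure is a smooth positive
function on `Σ`. Both the case without boundary and the case with boundary are covered, since `M₀`
only contains interior points. -/
structure IsRegularSection (k : ℕ) (ι : S → M) : Prop where
  isOpen_nonFixedInterior : IsOpen (nonFixedInterior G I M)
  isOpen_regularPart : IsOpen (regularPart G I ι)
  isConnected_regularPart : IsConnected (regularPart G I ι)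
  sweep : ∀ x ∈ nonFixedInterior G I M, ∃ g : G, ∃ s ∈ regularPart G I ι, g • ι s = x
  volume_pos : ∀ s ∈ regularPart G I ι, 0 < orbitVolume G I k (ι s)
  volume_lt_top : ∀ s ∈ regularPart G I ι, orbitVolume G I k (ι s) < ⊤
  volume_smooth : ContMDiffOn IS 𝓘(ℝ, ℝ) ∞ (fun s => (orbitVolume G I k (ι s)).toReal)
    (regularPart G I ι)

/-- `γ` is a parametrization by arclength of `Σ` on the open interval `D`. -/
structure IsArclengthParametrization (ι : S → M) (γ : ℝ → S) (D : Set ℝ) : Prop where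
  isOpen : IsOpen D
  ordConnected : D.OrdConnected
  bijOn : Set.BijOn γ D (regularPart G I ι)
  smooth : ContMDiffOn 𝓘(ℝ, ℝ) IS ∞ γ D
  unit_speed : ∀ t ∈ D, ‖mfderiv 𝓘(ℝ, ℝ) I (ι ∘ γ) t (1 : ℝ)‖ = 1

/-- The change of variables `s = J(r) = ∫_{r₀}^r A(t)⁻¹ dt`, where `A(t)` is the Riemannian measure
of the orbit through the point of `Σ` with arclength parameter `t`. -/
def arclengthChange (k : ℕ) (ι : S → M) (γ : ℝ → S) (r₀ r : ℝ) : ℝ :=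
  ∫ t in r₀..r, ((orbitVolume G I k (ι (γ t))).toReal)⁻¹

/-- `J` maps `D` onto `T` as a diffeomorphism of class `C²`. -/
structure IsC2Diffeo (J : ℝ → ℝ) (D T : Set ℝ) : Prop where
  bijOn : Set.BijOn J D T
  contDiffOn : ContDiffOn ℝ 2 J D
  contDiffOn_inv : ContDiffOn ℝ 2 (Function.invFunOn J D) T

end Action

/-- `u` is a `C²` maximal radial solution of `Δ u + f(x, u) = 0`: it is of class `C²` and
`G`-invariant on `M₀`, and solves the equation at every point of `M₀`. The values of `u` outside
the open set `M₀` are irrelevant. -/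
structure IsMaximalRadialSolution (G : Type*) [Group G] {n : ℕ} {H : Type*} [TopologicalSpace H]
    (I : ModelWithCorners ℝ (EuclideanSpace ℝ (Fin n)) H)
    {M : Type*} [TopologicalSpace M] [ChartedSpace H M] [MulAction G M]
    [RiemannianBundle (fun x : M => TangentSpace I x)]
    (f : M → ℝ → ℝ) (u : M → ℝ) : Prop where
  contMDiffOn : ContMDiffOn I 𝓘(ℝ, ℝ) 2 u (nonFixedInterior G I M)
  radial : ∀ (g : G), ∀ x ∈ nonFixedInterior G I M, u (g • x) = u x
  solves : ∀ x ∈ nonFixedInterior G I M, laplaceBeltrami I u x + f x (u x) = 0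

end

/-!
Write `c = ι ∘ γ` for the section parametrized by arclength, `A(t)` for the volume of the orbit of
`c(t)` and `w = u ∘ c` for the profile of a radial solution `u`. The equation becomes
`(A w')' = -A f ≤ 0`. So the flux `P = A w'` is nonincreasing (`antitoneOn_flux`); in the variable
`J = ∫ dt / A` the flux is the derivative of `w`, which is therefore a nonnegative concave function
on all of `ℝ`, and hence constant (`deriv_eq_zero_of_antitoneOn_flux`). Since the orbits through the
section sweep out `M₀`, the solution `u` is constant.

The work is in the identity `A Δu = (A w')'` (`hasDerivAt_orbitVolume_mul_deriv`), which is only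
needed at points `t₀` with `w'(t₀) ≠ 0`: at a zero of `w'` the sign of `P'` follows from the sign
at the neighbouring points. Where `w' ≠ 0` the function `u` separates the orbits through the nearby
points of the section, and this replaces the slice theorem for the action.

* In the coordinates `(t, v) ↦ η(v) • c(t)`, with `η` a local slice of `G` transverse to the
  stabilizer, the metric has the form `dt² + h` (`metricForm_sliceMap`). Evaluating the divergence
  of the gradient in the preferred chart gives `Δu = (ρ w')' / ρ`, where `ρ = √det h`
  (`laplaceBeltrami_eq`, which rests on Jacobi's formula via `divergence_pushforward`).
* An element `g` fixing `c(t)` maps `c` to a unit speed curve which in slice coordinates is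
  `s ↦ (s, v(s))`. As `s ↦ (s, 0)` has unit speed as well, `v` is constant. So the stabilizers of
  all nearby points of `c` coincide (`smul_eq_of_smul_eq`).
* Hence `g • c(t) ↦ g • c(s)` is a well-defined equivariant bijection between nearby orbits. It maps
  parametrized pieces of one orbit to parametrized pieces of the other and multiplies all volume
  densities by the same factor `ρ(s) / ρ(t)`, so `A` is locally a constant multiple of `ρ`
  (`orbitVolume_mul_le`).
-/

set_option linter.unusedSectionVars false

open Filter Topology

/-! ### Differentials and Gram matrices in the model space -/

section Derivative

variable {E : Type*} [NormedAddCommGroup E] [NormedSpace ℝ E] {H : Type*} [TopologicalSpace H]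
  (I : ModelWithCorners ℝ E H) {M : Type*} [TopologicalSpace M] [ChartedSpace H M]
  {E' : Type*} [NormedAddCommGroup E'] [NormedSpace ℝ E'] {H' : Type*} [TopologicalSpace H']
  (I' : ModelWithCorners ℝ E' H') {M' : Type*} [TopologicalSpace M'] [ChartedSpace H' M']
  {E'' : Type*} [NormedAddCommGroup E''] [NormedSpace ℝ E''] {H'' : Type*} [TopologicalSpace H'']
  (I'' : ModelWithCorners ℝ E'' H'') {M'' : Type*} [TopologicalSpace M''] [ChartedSpace H'' M'']

/-- The differential of a map between manifolds as a continuous linear map between the model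
vector spaces, so that its type does not depend on the base points. -/
noncomputable def modelDeriv (f : M → M') (x : M) : E →L[ℝ] E' := mfderiv I I' f x

variable {I I' I''}

theorem modelDeriv_comp {g : M' → M''} {f : M → M'} {x : M}
    (hg : MDifferentiableAt I' I'' g (f x)) (hf : MDifferentiableAt I I' f x) :
    modelDeriv I I'' (fun y => g (f y)) x =
      (modelDeriv I' I'' g (f x)).comp (modelDeriv I I' f x) :=
  mfderiv_comp x hg hf

theorem Filter.EventuallyEq.modelDeriv_eq {f g : M → M'} {x : M} (h : f =ᶠ[𝓝 x] g) :
    modelDeriv I I' f x = modelDeriv I I' g x :=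
  h.mfderiv_eq

theorem modelDeriv_eq_fderiv (f : E → E') (x : E) :
    modelDeriv 𝓘(ℝ, E) 𝓘(ℝ, E') f x = fderiv ℝ f x :=
  mfderiv_eq_fderiv

end Derivative

section Metric

variable {E : Type*} [NormedAddCommGroup E] [NormedSpace ℝ E] {H : Type*} [TopologicalSpace H]
  (I : ModelWithCorners ℝ E H) {M : Type*} [TopologicalSpace M] [ChartedSpace H M]
  [RiemannianBundle (fun x : M => TangentSpace I x)]

/-- The Riemannian metric at `x` as a bilinear form on the model vector space. -/
noncomputable def metricForm (x : M) : E →ₗ[ℝ] E →ₗ[ℝ] ℝ :=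
  LinearMap.mk₂ ℝ (fun a b : TangentSpace I x => (inner ℝ a b : ℝ))
    (fun _ _ _ => inner_add_left _ _ _) (fun _ _ _ => real_inner_smul_left _ _ _)
    (fun _ _ _ => inner_add_right _ _ _) (fun _ _ _ => real_inner_smul_right _ _ _)

variable {I}

theorem metricForm_comm (x : M) (a b : E) : metricForm I x a b = metricForm I x b a :=
  real_inner_comm (F := TangentSpace I x) _ _

theorem eq_zero_of_metricForm_self (x : M) (a : E) (h : metricForm I x a a = 0) : a = 0 :=
  inner_self_eq_zero (𝕜 := ℝ) (E := TangentSpace I x).1 h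

variable (I)

/-- The Gram matrix of the images of the standard basis vectors under a linear map into the
tangent space at `x`. -/
noncomputable def gramOf {k : ℕ} (x : M) (L : EuclideanSpace ℝ (Fin k) →L[ℝ] E) :
    Matrix (Fin k) (Fin k) ℝ :=
  Matrix.of fun i j => metricForm I x (L (EuclideanSpace.single i (1 : ℝ)))
    (L (EuclideanSpace.single j (1 : ℝ)))

theorem gramMatrix_eq_gramOf {k : ℕ} (ψ : EuclideanSpace ℝ (Fin k) → M)
    (v : EuclideanSpace ℝ (Fin k)) :
    gramMatrix I ψ v = gramOf I (ψ v) (modelDeriv 𝓘(ℝ, EuclideanSpace ℝ (Fin k)) I ψ v) := rfl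

/-- The matrix of a linear map between Euclidean spaces in the standard bases. -/
noncomputable def stdMatrix {k l : ℕ}
    (A : EuclideanSpace ℝ (Fin k) →L[ℝ] EuclideanSpace ℝ (Fin l)) :
    Matrix (Fin l) (Fin k) ℝ :=
  Matrix.of fun i j => A (EuclideanSpace.single j (1 : ℝ)) i

theorem EuclideanSpace.eq_sum_single {k : ℕ} (v : EuclideanSpace ℝ (Fin k)) :
    v = ∑ i, v i • EuclideanSpace.single i (1 : ℝ) := by
  ext j
  simp [Finset.sum_apply, Pi.single_apply]

theorem stdMatrix_comp {k l n : ℕ} (A : EuclideanSpace ℝ (Fin l) →L[ℝ] EuclideanSpace ℝ (Fin n))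
    (B : EuclideanSpace ℝ (Fin k) →L[ℝ] EuclideanSpace ℝ (Fin l)) :
    stdMatrix (A.comp B) = stdMatrix A * stdMatrix B := by
  ext i j
  simp only [stdMatrix, Matrix.of_apply, Matrix.mul_apply, ContinuousLinearMap.comp_apply]
  conv_lhs => rw [EuclideanSpace.eq_sum_single (B _)]
  simp [mul_comm]

theorem stdMatrix_id {k : ℕ} :
    stdMatrix (ContinuousLinearMap.id ℝ (EuclideanSpace ℝ (Fin k))) = 1 := by
  ext i j
  simp [stdMatrix, Matrix.one_apply]

variable {I}

theorem gramOf_comp {k l : ℕ} (x : M) (L : EuclideanSpace ℝ (Fin l) →L[ℝ] E)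
    (A : EuclideanSpace ℝ (Fin k) →L[ℝ] EuclideanSpace ℝ (Fin l)) :
    gramOf I x (L.comp A) = (stdMatrix A).transpose * gramOf I x L * stdMatrix A := by
  have key : ∀ j, L (A (EuclideanSpace.single j (1 : ℝ))) =
      ∑ i, stdMatrix A i j • L (EuclideanSpace.single i (1 : ℝ)) := by
    intro j
    conv_lhs => rw [EuclideanSpace.eq_sum_single (A _)]
    simp [stdMatrix]
  ext i j
  simp only [gramOf, Matrix.of_apply, Matrix.mul_apply, ContinuousLinearMap.comp_apply, key,
    map_sum, map_smul, LinearMap.sum_apply, LinearMap.smul_apply, Matrix.transpose_apply,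
    smul_eq_mul, Finset.sum_mul, Finset.mul_sum]
  refine Finset.sum_congr rfl fun a _ => Finset.sum_congr rfl fun b _ => ?_
  ring

theorem gramOf_isSymm {k : ℕ} (x : M) (L : EuclideanSpace ℝ (Fin k) →L[ℝ] E) (i j : Fin k) :
    gramOf I x L i j = gramOf I x L j i :=
  metricForm_comm _ _ _

theorem gramOf_det_pos {k : ℕ} (x : M) (L : EuclideanSpace ℝ (Fin k) →L[ℝ] E)
    (hL : Function.Injective L) : 0 < (gramOf I x L).det := by
  have h1 : LinearIndependent ℝ (fun i : Fin k => EuclideanSpace.single i (1 : ℝ)) := by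
    have h := (EuclideanSpace.basisFun (Fin k) ℝ).toBasis.linearIndependent
    have e : ⇑(EuclideanSpace.basisFun (Fin k) ℝ).toBasis =
        fun i : Fin k => EuclideanSpace.single i (1 : ℝ) := by
      ext i
      simp
    rwa [e] at h
  have h2 : LinearIndependent ℝ (fun i => L (EuclideanSpace.single i (1 : ℝ))) :=
    h1.map' L.toLinearMap (LinearMap.ker_eq_bot.2 hL)
  have h3 : (gramOf I x L).PosDef :=
    Matrix.posDef_gram_of_linearIndependent (𝕜 := ℝ) (E := TangentSpace I x)
      (v := fun i => L (EuclideanSpace.single i (1 : ℝ))) h2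
  exact h3.det_pos

theorem injective_of_gramOf_det_ne_zero {k : ℕ} (x : M) (L : EuclideanSpace ℝ (Fin k) →L[ℝ] E)
    (h : (gramOf I x L).det ≠ 0) : Function.Injective L := by
  refine (injective_iff_map_eq_zero L).2 fun v hv => ?_
  have h1 : (gramOf I x L).mulVec (fun i => v i) = 0 := by
    ext i
    have : metricForm I x (L (EuclideanSpace.single i (1 : ℝ))) (L v) = 0 := by simp [hv]
    rw [EuclideanSpace.eq_sum_single v] at this
    simpa [Matrix.mulVec, dotProduct, gramOf, mul_comm] using this
  have h2 := Matrix.eq_zero_of_mulVec_eq_zero h h1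
  ext i
  exact congrFun h2 i

end Metric

/-! ### Jacobi's formula, the inverse function theorem and smoothness of Gram matrices -/

section Det

/-- Jacobi's formula: if `T` is a right inverse of `B s`, then
`(det B)'(s) = det (B s) * tr (T B')`. -/
theorem HasDerivAt.matrix_det {k : ℕ} {B : ℝ → Matrix (Fin k) (Fin k) ℝ}
    {B' T : Matrix (Fin k) (Fin k) ℝ} {s : ℝ}
    (hB : ∀ i j, HasDerivAt (fun r => B r i j) (B' i j) s) (hT : B s * T = 1) :
    HasDerivAt (fun r => (B r).det) ((B s).det * (T * B').trace) s := by
  -- the determinant is a polynomial in the entries, hence differentiable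
  have hdiff : Differentiable ℝ (fun A : Fin k → Fin k → ℝ => (Matrix.of A).det) := by
    simp only [Matrix.det_apply]
    simp only [Matrix.of_apply]
    fun_prop
  have hline : ∀ A : Matrix (Fin k) (Fin k) ℝ,
      HasDerivAt (fun r : ℝ => (1 + r • A).det) A.trace 0 := by
    intro A
    have h := Matrix.derivative_det_one_add_X_smul A
    have h2 := (Polynomial.hasDerivAt
      (Matrix.det (1 + (Polynomial.X : Polynomial ℝ) • A.map Polynomial.C)) 0)
    rw [h] at h2
    refine h2.congr_of_eventuallyEq (Filter.Eventually.of_forall fun r => ?_)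
    simp only
    rw [← Polynomial.coe_evalRingHom, RingHom.map_det]
    congr 1
    ext i j
    simp [Matrix.one_apply, apply_ite]
    ring
  have hcurve : HasDerivAt (fun r => (fun i j => B r i j : Fin k → Fin k → ℝ))
      (fun i j => B' i j) s :=
    hasDerivAt_pi.2 fun i => hasDerivAt_pi.2 fun j => hB i j
  have h1 := (hdiff (fun i j => B s i j)).hasFDerivAt.comp_hasDerivAt s hcurve
  -- the differential of `det` at `B s` is evaluated along the line `B s + r B'`
  have h2 : HasDerivAt (fun r : ℝ => (fun i j => B s i j + r * B' i j : Fin k → Fin k → ℝ))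
      (fun i j => B' i j) 0 := by
    refine hasDerivAt_pi.2 fun i => hasDerivAt_pi.2 fun j => ?_
    simpa using ((hasDerivAt_id (0 : ℝ)).mul_const (B' i j)).const_add (B s i j)
  have h3 : HasDerivAt (fun r : ℝ => (Matrix.of fun i j => B s i j + r * B' i j).det)
      (fderiv ℝ (fun A : Fin k → Fin k → ℝ => (Matrix.of A).det) (fun i j => B s i j)
        (fun i j => B' i j)) 0 := by
    have h0 : (fun i j => B s i j + (0 : ℝ) * B' i j : Fin k → Fin k → ℝ) = fun i j => B s i j := by
      simp
    have := hdiff (fun i j => B s i j)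
    rw [← h0] at this
    have h4 := this.hasFDerivAt.comp_hasDerivAt (0 : ℝ) h2
    rw [h0] at h4
    exact h4
  have h5 : HasDerivAt (fun r : ℝ => (Matrix.of fun i j => B s i j + r * B' i j).det)
      ((B s).det * (T * B').trace) 0 := by
    refine ((hline (T * B')).const_mul (B s).det).congr_of_eventuallyEq
      (Filter.Eventually.of_forall fun r => ?_)
    simp only
    rw [← Matrix.det_mul, mul_add, mul_one, Matrix.mul_smul, ← mul_assoc, hT, one_mul]
    rfl
  rw [h3.unique h5] at h1
  exact h1

end Det

section LocalInverse

variable {n : ℕ} {H : Type*} [TopologicalSpace H]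
  {I : ModelWithCorners ℝ (EuclideanSpace ℝ (Fin n)) H}
  {M : Type*} [TopologicalSpace M] [ChartedSpace H M] [IsManifold I ∞ M]

local notation "𝔼" => EuclideanSpace ℝ (Fin n)

/-- The inverse function theorem for a map from a Euclidean space into a manifold of the same
dimension. -/
theorem exists_local_inverse {Φ : 𝔼 → M} {q₀ : 𝔼} (hΦ : ContMDiffAt 𝓘(ℝ, 𝔼) I ∞ Φ q₀)
    (hinj : Function.Injective (modelDeriv 𝓘(ℝ, 𝔼) I Φ q₀)) :
    ∃ Ψ : M → 𝔼, ContMDiffAt I 𝓘(ℝ, 𝔼) ∞ Ψ (Φ q₀) ∧ Ψ (Φ q₀) = q₀ ∧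
      (∀ᶠ y in 𝓝 (Φ q₀), Φ (Ψ y) = y) ∧ ∀ᶠ q in 𝓝 q₀, Ψ (Φ q) = q := by
  set e := extChartAt I (Φ q₀) with he
  have hψ : ContMDiffAt 𝓘(ℝ, 𝔼) 𝓘(ℝ, 𝔼) ∞ (fun q => e (Φ q)) q₀ :=
    ContMDiffAt.comp q₀ (contMDiffAt_extChartAt (n := ∞)) hΦ
  have hψ' : ContDiffAt ℝ ∞ (fun q => e (Φ q)) q₀ := hψ.contDiffAt
  have hd : fderiv ℝ (fun q => e (Φ q)) q₀ =
      (modelDeriv I 𝓘(ℝ, 𝔼) e (Φ q₀)).comp (modelDeriv 𝓘(ℝ, 𝔼) I Φ q₀) := by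
    rw [← modelDeriv_eq_fderiv]
    exact modelDeriv_comp (mdifferentiableAt_extChartAt (mem_chart_source H _))
      (hΦ.mdifferentiableAt (by simp))
  have hinv : Function.Injective (modelDeriv I 𝓘(ℝ, 𝔼) e (Φ q₀)) := by
    have := isInvertible_mfderiv_extChartAt (I := I) (mem_extChartAt_source (I := I) (Φ q₀))
    exact this.injective
  have hinj' : Function.Injective (fderiv ℝ (fun q => e (Φ q)) q₀) := by
    rw [hd]
    exact hinv.comp hinj
  let L : 𝔼 ≃L[ℝ] 𝔼 := (LinearEquiv.ofInjectiveEndo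
    (fderiv ℝ (fun q => e (Φ q)) q₀).toLinearMap hinj').toContinuousLinearEquiv
  have hL : HasFDerivAt (fun q => e (Φ q)) (L : 𝔼 →L[ℝ] 𝔼) q₀ := by
    have : (L : 𝔼 →L[ℝ] 𝔼) = fderiv ℝ (fun q => e (Φ q)) q₀ := by
      ext v
      rfl
    rw [this]
    exact (hψ'.differentiableAt (by simp)).hasFDerivAt
  have hs : HasStrictFDerivAt (fun q => e (Φ q)) (L : 𝔼 →L[ℝ] 𝔼) q₀ :=
    hψ'.hasStrictFDerivAt' hL (by simp)
  set θ := hψ'.localInverse hL (by simp) with hθ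
  have hθ0 : θ (e (Φ q₀)) = q₀ := hψ'.localInverse_apply_image hL (by simp)
  have hθs : ContDiffAt ℝ ∞ θ (e (Φ q₀)) := hψ'.to_localInverse hL (by simp)
  have hr : ∀ᶠ y in 𝓝 (e (Φ q₀)), e (Φ (θ y)) = y := hs.eventually_right_inverse
  have hl : ∀ᶠ q in 𝓝 q₀, θ (e (Φ q)) = q := hs.eventually_left_inverse
  have hec : ContinuousAt e (Φ q₀) := continuousAt_extChartAt _
  have hsm : ContMDiffAt I 𝓘(ℝ, 𝔼) ∞ (fun y => θ (e y)) (Φ q₀) :=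
    ContMDiffAt.comp (Φ q₀) hθs.contMDiffAt (contMDiffAt_extChartAt (n := ∞))
  refine ⟨fun y => θ (e y), hsm, hθ0, ?_, hl⟩
  have hsrc : ∀ᶠ y in 𝓝 (Φ q₀), y ∈ e.source := extChartAt_source_mem_nhds (I := I) (Φ q₀)
  have hsrc2 : ∀ᶠ y in 𝓝 (Φ q₀), Φ (θ (e y)) ∈ e.source := by
    have hc : ContinuousAt (fun y => Φ (θ (e y))) (Φ q₀) := by
      refine ContinuousAt.comp (g := Φ) ?_ hsm.continuousAt
      rw [hθ0]
      exact hΦ.continuousAt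
    refine hc.eventually ?_
    simp only [hθ0]
    exact hsrc
  filter_upwards [hsrc, hsrc2, hec.eventually hr] with y h1 h2 h3
  exact e.injOn h2 h1 h3

end LocalInverse

section GramSmooth

variable {E : Type*} [NormedAddCommGroup E] [NormedSpace ℝ E] {H : Type*} [TopologicalSpace H]
  {I : ModelWithCorners ℝ E H} {M : Type*} [TopologicalSpace M] [ChartedSpace H M]
  [IsManifold I ∞ M]
  [RiemannianBundle (fun x : M => TangentSpace I x)]
  [IsContMDiffRiemannianBundle I ∞ E (fun x : M => TangentSpace I x)]

theorem contDiffOn_gramMatrix {k : ℕ} {ψ : EuclideanSpace ℝ (Fin k) → M}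
    {O : Set (EuclideanSpace ℝ (Fin k))} (hO : IsOpen O)
    (hψ : ContMDiffOn 𝓘(ℝ, EuclideanSpace ℝ (Fin k)) I ∞ ψ O) (i j : Fin k) :
    ContDiffOn ℝ ∞ (fun q => gramMatrix I ψ q i j) O := by
  have key : ∀ i : Fin k, ContMDiffOn 𝓘(ℝ, EuclideanSpace ℝ (Fin k)) I.tangent ∞
      (fun q => (⟨ψ q, mfderiv 𝓘(ℝ, EuclideanSpace ℝ (Fin k)) I ψ q
        (EuclideanSpace.single i (1 : ℝ) : EuclideanSpace ℝ (Fin k))⟩ : TangentBundle I M)) O := by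
    intro i
    have h1 := hψ.contMDiffOn_tangentMapWithin (m := ∞) (by simp) hO.uniqueMDiffOn
    have h2 : ContMDiffOn 𝓘(ℝ, EuclideanSpace ℝ (Fin k))
        𝓘(ℝ, EuclideanSpace ℝ (Fin k)).tangent ∞
        (fun q => (⟨q, (EuclideanSpace.single i (1 : ℝ) : EuclideanSpace ℝ (Fin k))⟩ :
          TangentBundle 𝓘(ℝ, EuclideanSpace ℝ (Fin k)) (EuclideanSpace ℝ (Fin k)))) O :=
      contMDiffOn_vectorSpace_iff_contDiffOn.2 contDiffOn_const
    have h3 := h1.comp h2 (fun q hq => hq)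
    refine h3.congr fun q hq => ?_
    simp only [Function.comp, tangentMapWithin]
    rw [mfderivWithin_of_isOpen hO hq]
  have h := ContMDiffOn.inner_bundle (IB := I) (F := E) (E := fun x : M => TangentSpace I x)
    (b := ψ)
    (v := fun q => mfderiv 𝓘(ℝ, EuclideanSpace ℝ (Fin k)) I ψ q
      (EuclideanSpace.single i (1 : ℝ) : EuclideanSpace ℝ (Fin k)))
    (w := fun q => mfderiv 𝓘(ℝ, EuclideanSpace ℝ (Fin k)) I ψ q
      (EuclideanSpace.single j (1 : ℝ) : EuclideanSpace ℝ (Fin k))) (key i) (key j)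
  exact h.contDiffOn

end GramSmooth

/-! ### Divergence in changed coordinates -/

/-- If `C = Bᵀ g B` is block diagonal with first block `1`, and `d` is the covector with
`Bᵀ d = a e₀`, then `√(det g) g⁻¹ d = √(det C) a |det B|⁻¹ B e₀`. -/
theorem sum_inv_mul_sqrt_det {m : ℕ} {B g C : Matrix (Fin (m + 1)) (Fin (m + 1)) ℝ}
    {d : Fin (m + 1) → ℝ} {a : ℝ} (hC : B.transpose * g * B = C) (hg : ∀ i j, g i j = g j i)
    (hCrow : ∀ j, C j 0 = if j = 0 then 1 else 0) (hB : B.det ≠ 0) (hgd : g.det ≠ 0)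
    (hd : ∀ j, ∑ i, d i * B i j = if j = 0 then a else 0) (k : Fin (m + 1)) :
    ∑ i, g⁻¹ i k * √g.det * d i = √C.det * a / |B.det| * B k 0 := by
  have hsqrt : √C.det = |B.det| * √g.det := by
    have : C.det = B.det ^ 2 * g.det := by
      rw [← hC, Matrix.det_mul, Matrix.det_mul, Matrix.det_transpose]
      ring
    rw [this, Real.sqrt_mul (sq_nonneg _), Real.sqrt_sq_eq_abs]
  have hgT : g.transpose = g := by
    ext i j
    exact hg j i
  have hinvT : ∀ i j, g⁻¹ i j = g⁻¹ j i := by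
    intro i j
    have : (g⁻¹).transpose = g⁻¹ := by rw [Matrix.transpose_nonsing_inv, hgT]
    exact congrFun (congrFun this j) i
  have hBu : IsUnit B.transpose.det := by
    rw [Matrix.det_transpose]
    exact isUnit_iff_ne_zero.2 hB
  -- `g B e₀ = B⁻ᵀ e₀`, which gives `d = a g B e₀`
  have h1 : B.transpose.mulVec d = B.transpose.mulVec (a • g.mulVec (fun i => B i 0)) := by
    ext j
    have e1 : B.transpose.mulVec d j = ∑ i, d i * B i j := by
      simp [Matrix.mulVec, dotProduct, mul_comm]
    have e2 : B.transpose.mulVec (g.mulVec (fun i => B i 0)) j = C j 0 := by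
      rw [← hC, Matrix.mulVec_mulVec]
      rfl
    rw [e1, hd, Matrix.mulVec_smul, Pi.smul_apply, e2, hCrow]
    simp
  have h2 : d = a • g.mulVec (fun i => B i 0) := by
    have h3 := congrArg (B.transpose)⁻¹.mulVec h1
    rwa [Matrix.mulVec_mulVec, Matrix.mulVec_mulVec, Matrix.nonsing_inv_mul _ hBu,
      Matrix.one_mulVec, Matrix.one_mulVec] at h3
  have h3 : g⁻¹.mulVec d = a • (fun i => B i 0) := by
    rw [h2, Matrix.mulVec_smul, Matrix.mulVec_mulVec,
      Matrix.nonsing_inv_mul _ (isUnit_iff_ne_zero.2 hgd), Matrix.one_mulVec]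
  have h4 : ∑ i, g⁻¹ k i * d i = a * B k 0 := by
    have := congrFun h3 k
    simpa [Matrix.mulVec, dotProduct] using this
  have h5 : ∑ i, g⁻¹ i k * √g.det * d i = √g.det * ∑ i, g⁻¹ k i * d i := by
    rw [Finset.mul_sum]
    refine Finset.sum_congr rfl fun i _ => ?_
    rw [hinvT i k]
    ring
  rw [h5, h4, hsqrt]
  have := abs_ne_zero.2 hB
  field_simp

section PushForward

variable {m : ℕ}

local notation "𝔼" => EuclideanSpace ℝ (Fin (m + 1))

/-- The divergence of the push-forward under `ψ` of the vector field `ρ |det Dψ|⁻¹ ∂₀`: it is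
`|det Dψ|⁻¹ ∂₀ρ`. The map `θ` is a local inverse of `ψ`. -/
theorem divergence_pushforward {ψ θ : 𝔼 → 𝔼} {q₀ : 𝔼} (hψ : ContDiffAt ℝ 2 ψ q₀)
    (hθ : DifferentiableAt ℝ θ (ψ q₀)) (hθ0 : θ (ψ q₀) = q₀)
    (hr : ∀ᶠ y in 𝓝 (ψ q₀), ψ (θ y) = y)
    {h : 𝔼 → ℝ} (hh : DifferentiableAt ℝ h q₀) {h' : ℝ}
    (hh' : HasDerivAt (fun s : ℝ => h (q₀ + s • EuclideanSpace.single 0 (1 : ℝ))) h' 0) :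
    ∑ k, fderiv ℝ (fun y => h (θ y) / |(stdMatrix (fderiv ℝ ψ (θ y))).det| *
        stdMatrix (fderiv ℝ ψ (θ y)) k 0) (ψ q₀) (EuclideanSpace.single k (1 : ℝ)) =
      h' / |(stdMatrix (fderiv ℝ ψ q₀)).det| := by
  set e₀ : 𝔼 := EuclideanSpace.single 0 (1 : ℝ) with he₀
  set B : 𝔼 → Matrix (Fin (m + 1)) (Fin (m + 1)) ℝ := fun q => stdMatrix (fderiv ℝ ψ q) with hB
  set T := fderiv ℝ θ (ψ q₀) with hT
  have hψd : DifferentiableAt ℝ ψ q₀ := hψ.differentiableAt (by norm_num)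
  have hBT : (fderiv ℝ ψ q₀).comp T = ContinuousLinearMap.id ℝ 𝔼 := by
    have h1 : HasFDerivAt (fun y => ψ (θ y)) ((fderiv ℝ ψ q₀).comp T) (ψ q₀) := by
      refine HasFDerivAt.comp (ψ q₀) ?_ hθ.hasFDerivAt
      rw [hθ0]
      exact hψd.hasFDerivAt
    have h2 : HasFDerivAt (fun y => ψ (θ y)) (ContinuousLinearMap.id ℝ 𝔼) (ψ q₀) :=
      (hasFDerivAt_id (ψ q₀)).congr_of_eventuallyEq hr
    exact h1.unique h2
  have hBT' : B q₀ * stdMatrix T = 1 := by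
    rw [hB]
    simp only
    rw [← stdMatrix_comp, hBT, stdMatrix_id]
  have hTB' : stdMatrix T * B q₀ = 1 := mul_eq_one_comm.1 hBT'
  have hdet : (B q₀).det ≠ 0 := by
    intro h0
    have := congrArg Matrix.det hBT'
    rw [Matrix.det_mul, h0] at this
    simp at this
  -- the second derivative of `ψ`
  have hD : DifferentiableAt ℝ (fderiv ℝ ψ) q₀ :=
    (hψ.fderiv_right (m := 1) (by norm_num)).differentiableAt (by norm_num)
  set D2 := fderiv ℝ (fderiv ℝ ψ) q₀ with hD2
  have hBij : ∀ i j, HasFDerivAt (fun q => B q i j)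
      ((EuclideanSpace.proj i : 𝔼 →L[ℝ] ℝ).comp
        ((ContinuousLinearMap.apply ℝ 𝔼 (EuclideanSpace.single j (1 : ℝ) : 𝔼)).comp D2)) q₀ := by
    intro i j
    exact ((EuclideanSpace.proj i : 𝔼 →L[ℝ] ℝ).comp (ContinuousLinearMap.apply ℝ 𝔼
      (EuclideanSpace.single j (1 : ℝ) : 𝔼))).hasFDerivAt.comp q₀ hD.hasFDerivAt
  have hsymm : ∀ a b : 𝔼, D2 a b = D2 b a := by
    have := hψ.isSymmSndFDerivAt (by simp)
    exact fun a b => this.eq a b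
  set B' : Matrix (Fin (m + 1)) (Fin (m + 1)) ℝ :=
    Matrix.of fun i j => D2 e₀ (EuclideanSpace.single j (1 : ℝ)) i with hB'
  have hline : HasDerivAt (fun s : ℝ => q₀ + s • e₀) e₀ 0 := by
    simpa using ((hasDerivAt_id (0 : ℝ)).smul_const e₀).const_add q₀
  have hline0 : q₀ + (0 : ℝ) • e₀ = q₀ := by simp
  have hBline : ∀ i j, HasDerivAt (fun s : ℝ => B (q₀ + s • e₀) i j) (B' i j) 0 := by
    intro i j
    have h1 := hBij i j
    rw [← hline0] at h1
    exact h1.comp_hasDerivAt (0 : ℝ) hline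
  have hdetline : HasDerivAt (fun s : ℝ => (B (q₀ + s • e₀)).det)
      ((B q₀).det * (stdMatrix T * B').trace) 0 := by
    have := HasDerivAt.matrix_det (B := fun s : ℝ => B (q₀ + s • e₀)) hBline
      (T := stdMatrix T) (by simpa using hBT')
    simpa using this
  set δ : 𝔼 → ℝ := fun q => h q / |(B q).det| with hδ
  have hδdiff : DifferentiableAt ℝ δ q₀ := by
    have h1 : DifferentiableAt ℝ (fun q => (B q).det) q₀ := by
      simp only [Matrix.det_apply]
      have : ∀ i j, DifferentiableAt ℝ (fun q => B q i j) q₀ :=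
        fun i j => (hBij i j).differentiableAt
      fun_prop
    have h2 : DifferentiableAt ℝ (fun q => |(B q).det|) q₀ := h1.abs hdet
    have h3 : DifferentiableAt ℝ (fun q => (|(B q).det|)⁻¹) q₀ := h2.inv (abs_ne_zero.2 hdet)
    simp only [hδ, div_eq_mul_inv]
    exact hh.mul h3
  have hδline : fderiv ℝ δ q₀ e₀ =
      h' / |(B q₀).det| - δ q₀ * (stdMatrix T * B').trace := by
    have h1 : HasDerivAt (fun s : ℝ => δ (q₀ + s • e₀)) (fderiv ℝ δ q₀ e₀) 0 := by
      have h2 := hδdiff.hasFDerivAt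
      rw [← hline0] at h2
      have h3 := h2.comp_hasDerivAt (0 : ℝ) hline
      rw [hline0] at h3
      exact h3
    have hdet' : (B (q₀ + (0 : ℝ) • e₀)).det ≠ 0 := by rwa [hline0]
    have habs : HasDerivAt (fun s : ℝ => |(B (q₀ + s • e₀)).det|)
        ((SignType.sign (B (q₀ + (0 : ℝ) • e₀)).det : ℝ) *
          ((B q₀).det * (stdMatrix T * B').trace)) 0 :=
      HasDerivAt.comp (h₂ := fun x : ℝ => |x|) (h := fun s : ℝ => (B (q₀ + s • e₀)).det) (0 : ℝ)
        (hasDerivAt_abs hdet') hdetline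
    have h2 := HasDerivAt.fun_div (d := fun s : ℝ => |(B (q₀ + s • e₀)).det|) hh' habs
      (abs_ne_zero.2 hdet')
    rw [h1.unique h2]
    simp only [zero_smul, add_zero, hδ]
    have hs : (SignType.sign (B q₀).det : ℝ) * (B q₀).det = |(B q₀).det| := sign_mul_self _
    have ha := abs_ne_zero.2 hdet
    rw [← mul_assoc (SignType.sign (B q₀).det : ℝ), hs]
    field_simp
  have hterm : ∀ k, fderiv ℝ (fun y => δ (θ y) * B (θ y) k 0) (ψ q₀)
        (EuclideanSpace.single k (1 : ℝ)) =
      B q₀ k 0 * fderiv ℝ δ q₀ (T (EuclideanSpace.single k (1 : ℝ))) +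
      δ q₀ * D2 (T (EuclideanSpace.single k (1 : ℝ))) e₀ k := by
    intro k
    have h1 : HasFDerivAt (fun q => δ q * B q k 0) _ q₀ := hδdiff.hasFDerivAt.mul (hBij k 0)
    rw [← hθ0] at h1
    have h2 := h1.comp (ψ q₀) hθ.hasFDerivAt
    rw [hθ0] at h2
    have h3 := h2.fderiv
    simp only [Function.comp_def] at h3
    rw [h3]
    simp [← hT, ← he₀]
    ring
  have hsum1 : ∑ k, B q₀ k 0 * fderiv ℝ δ q₀ (T (EuclideanSpace.single k (1 : ℝ))) =
      fderiv ℝ δ q₀ e₀ := by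
    have h1 : T (fderiv ℝ ψ q₀ e₀) = e₀ := by
      have h2 : stdMatrix (T.comp (fderiv ℝ ψ q₀)) = 1 := by rw [stdMatrix_comp, hTB']
      ext i
      have h3 := congrFun (congrFun h2 i) 0
      simpa [stdMatrix, Matrix.one_apply, he₀, Pi.single_apply] using h3
    conv_rhs => rw [← h1, EuclideanSpace.eq_sum_single (fderiv ℝ ψ q₀ e₀)]
    simp [hB, stdMatrix, he₀]
  have hsum2 : ∑ k, D2 (T (EuclideanSpace.single k (1 : ℝ))) e₀ k =
      (stdMatrix T * B').trace := by
    rw [Matrix.trace_mul_comm]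
    simp only [Matrix.trace, Matrix.diag, Matrix.mul_apply, hB', Matrix.of_apply, stdMatrix]
    refine Finset.sum_congr rfl fun k _ => ?_
    rw [hsymm]
    conv_lhs => rw [EuclideanSpace.eq_sum_single (T _)]
    simp [mul_comm]
  calc ∑ k, fderiv ℝ (fun y => δ (θ y) * B (θ y) k 0) (ψ q₀) (EuclideanSpace.single k (1 : ℝ))
      = fderiv ℝ δ q₀ e₀ + δ q₀ * (stdMatrix T * B').trace := by
        rw [Finset.sum_congr rfl fun k _ => hterm k, Finset.sum_add_distrib, hsum1,
          ← Finset.mul_sum, hsum2]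
    _ = h' / |(B q₀).det| := by rw [hδline]; ring

end PushForward

/-! ### The Laplace–Beltrami operator in adapted coordinates -/

section Laplacian

variable {m : ℕ} {H : Type*} [TopologicalSpace H]
  {I : ModelWithCorners ℝ (EuclideanSpace ℝ (Fin (m + 1))) H}
  {M : Type*} [TopologicalSpace M] [ChartedSpace H M] [IsManifold I ∞ M]
  [RiemannianBundle (fun x : M => TangentSpace I x)]

local notation "𝔼" => EuclideanSpace ℝ (Fin (m + 1))

/-- The chain rule for the Gram matrix of a map read in the preferred chart at `p`. -/
theorem gramMatrix_eq_metricMatrix {p : M} {Φ : 𝔼 → M} {q : 𝔼}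
    (hΦ : ContMDiffAt 𝓘(ℝ, 𝔼) I ∞ Φ q) (hsrc : Φ q ∈ (extChartAt I p).source)
    (hrange : Set.range I ∈ 𝓝 (extChartAt I p (Φ q))) :
    (stdMatrix (fderiv ℝ (fun q => extChartAt I p (Φ q)) q)).transpose *
      metricMatrix I p (extChartAt I p (Φ q)) *
      stdMatrix (fderiv ℝ (fun q => extChartAt I p (Φ q)) q) = gramMatrix I Φ q := by
  set e := extChartAt I p with he
  have hsymm : e.symm (e (Φ q)) = Φ q := e.left_inv hsrc
  have htgt : e (Φ q) ∈ e.target := e.map_source hsrc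
  have hψ : ContMDiffAt 𝓘(ℝ, 𝔼) 𝓘(ℝ, 𝔼) ∞ (fun q => e (Φ q)) q :=
    ContMDiffAt.comp q (contMDiffAt_extChartAt' (by rwa [← extChartAt_source I])) hΦ
  have hes : MDifferentiableAt 𝓘(ℝ, 𝔼) I e.symm (e (Φ q)) :=
    (mdifferentiableWithinAt_extChartAt_symm htgt).mdifferentiableAt hrange
  have hΦe : Φ =ᶠ[𝓝 q] fun r => e.symm (e (Φ r)) := by
    have : ∀ᶠ r in 𝓝 q, Φ r ∈ e.source :=
      hΦ.continuousAt.eventually ((isOpen_extChartAt_source p).mem_nhds hsrc)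
    filter_upwards [this] with r hr
    exact (e.left_inv hr).symm
  have hd : modelDeriv 𝓘(ℝ, 𝔼) I Φ q =
      (modelDeriv 𝓘(ℝ, 𝔼) I e.symm (e (Φ q))).comp (fderiv ℝ (fun q => e (Φ q)) q) := by
    rw [hΦe.modelDeriv_eq, ← modelDeriv_eq_fderiv]
    exact modelDeriv_comp hes (hψ.mdifferentiableAt (by simp))
  have hg : metricMatrix I p (e (Φ q)) =
      gramOf I (e.symm (e (Φ q))) (modelDeriv 𝓘(ℝ, 𝔼) I e.symm (e (Φ q))) := by
    ext i j
    simp only [metricMatrix, coordVector, Matrix.of_apply]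
    rw [mfderivWithin_of_mem_nhds hrange]
    rfl
  rw [gramMatrix_eq_gramOf, hd, gramOf_comp, hg, hsymm]

/-- The Laplace–Beltrami operator annihilates functions that are constant near an interior
point. -/
theorem laplaceBeltrami_eq_zero_of_eventually_const {u : M → ℝ} {p : M} {c : ℝ}
    (hint : I.IsInteriorPoint p) (hu : ∀ᶠ x in 𝓝 p, u x = c) : laplaceBeltrami I u p = 0 := by
  have hrange : Set.range I ∈ 𝓝 (extChartAt I p p) := range_mem_nhds_isInteriorPoint hint
  have hes : Tendsto (extChartAt I p).symm (𝓝 (extChartAt I p p)) (𝓝 p) := by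
    have h := (contMDiffWithinAt_extChartAt_symm_range (I := I) (n := ∞) p
      (mem_extChartAt_target (I := I) p)).continuousWithinAt.continuousAt hrange
    rwa [ContinuousAt, extChartAt_to_inv] at h
  have h1 : (u ∘ (extChartAt I p).symm) =ᶠ[𝓝 (extChartAt I p p)] fun _ => c := hes.eventually hu
  have h2 : ∀ i, ∀ᶠ y in 𝓝 (extChartAt I p p),
      coordDeriv I (u ∘ (extChartAt I p).symm) y i = 0 := by
    intro i
    filter_upwards [h1.eventually_nhds, eventually_mem_nhds_iff.2 hrange] with y h3 h4
    have h3' : (u ∘ (extChartAt I p).symm) =ᶠ[𝓝 y] fun _ => c := h3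
    rw [coordDeriv, fderivWithin_of_mem_nhds h4, h3'.fderiv_eq]
    simp
  rw [laplaceBeltrami]
  refine mul_eq_zero_of_right _ (Finset.sum_eq_zero fun k _ => ?_)
  have h3 : (fun y => ∑ i, (metricMatrix I p y)⁻¹ i k * √(metricMatrix I p y).det *
      coordDeriv I (u ∘ (extChartAt I p).symm) y i) =ᶠ[𝓝 (extChartAt I p p)] fun _ => 0 := by
    filter_upwards [eventually_all.2 h2] with y h4
    exact Finset.sum_eq_zero fun i _ => by rw [h4 i, mul_zero]
  rw [coordDeriv, fderivWithin_of_mem_nhds hrange, h3.fderiv_eq]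
  simp

variable [IsContMDiffRiemannianBundle I ∞ (EuclideanSpace ℝ (Fin (m + 1)))
    (fun x : M => TangentSpace I x)]

/-- The Laplacian in coordinates `Φ` in which the metric is `dt² + h`, of a function which depends
only on `t`: it is `(ρ w')' / ρ` with `ρ = √det h`. The weighted gradient of `u` is the push-forward
of `ρ w' |det Dψ|⁻¹ ∂₀`, where `ψ` is `Φ` read in the preferred chart. -/
theorem laplaceBeltrami_eq {Φ : 𝔼 → M} {O : Set 𝔼} {q₀ : 𝔼} (hO : IsOpen O) (hq₀ : q₀ ∈ O)
    (hΦ : ContMDiffOn 𝓘(ℝ, 𝔼) I ∞ Φ O) (hint : I.IsInteriorPoint (Φ q₀))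
    (hinj : Function.Injective (modelDeriv 𝓘(ℝ, 𝔼) I Φ q₀))
    (hrow : ∀ q ∈ O, ∀ j, gramMatrix I Φ q j 0 = if j = 0 then 1 else 0)
    {u : M → ℝ} {w : ℝ → ℝ} (hw : ContDiffAt ℝ 2 w (q₀ 0)) (huw : ∀ q ∈ O, u (Φ q) = w (q 0))
    {ρ' : ℝ} (hρ' : HasDerivAt (fun s : ℝ =>
      √(gramMatrix I Φ (q₀ + s • EuclideanSpace.single 0 (1 : ℝ))).det) ρ' 0) :
    laplaceBeltrami I u (Φ q₀) =
      (ρ' * deriv w (q₀ 0) + √(gramMatrix I Φ q₀).det * deriv (deriv w) (q₀ 0)) /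
        √(gramMatrix I Φ q₀).det := by
  set e := extChartAt I (Φ q₀) with he
  set ψ : 𝔼 → 𝔼 := fun q => e (Φ q) with hψdef
  set ρ : 𝔼 → ℝ := fun q => √(gramMatrix I Φ q).det with hρdef
  have hΦ0 : ContMDiffAt 𝓘(ℝ, 𝔼) I ∞ Φ q₀ := hΦ.contMDiffAt (hO.mem_nhds hq₀)
  have hrange : Set.range I ∈ 𝓝 (ψ q₀) := range_mem_nhds_isInteriorPoint hint
  have hψ : ContDiffAt ℝ ∞ ψ q₀ :=
    (ContMDiffAt.comp q₀ (contMDiffAt_extChartAt (n := ∞)) hΦ0).contDiffAt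
  obtain ⟨Ψ, hΨs, hΨ0, hΨr, hΨl⟩ := exists_local_inverse hΦ0 hinj
  -- the inverse of `ψ` in coordinates
  set θ : 𝔼 → 𝔼 := fun y => Ψ (e.symm y) with hθdef
  have hsymm0 : e.symm (ψ q₀) = Φ q₀ := extChartAt_to_inv (I := I) (Φ q₀)
  have hθ0 : θ (ψ q₀) = q₀ := by rw [hθdef]; simp only [hsymm0, hΨ0]
  have htgt0 : ψ q₀ ∈ e.target := mem_extChartAt_target (I := I) (Φ q₀)
  have hesymm : ContMDiffAt 𝓘(ℝ, 𝔼) I ∞ e.symm (ψ q₀) :=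
    (contMDiffWithinAt_extChartAt_symm_range (n := ∞) (Φ q₀) htgt0).contMDiffAt hrange
  have hθs : ContDiffAt ℝ ∞ θ (ψ q₀) := by
    have : ContMDiffAt I 𝓘(ℝ, 𝔼) ∞ Ψ (e.symm (ψ q₀)) := by rwa [hsymm0]
    exact (ContMDiffAt.comp (ψ q₀) this hesymm).contDiffAt
  have htgt : ∀ᶠ y in 𝓝 (ψ q₀), y ∈ e.target := by
    have h1 : e.target ∈ 𝓝[Set.range I] (ψ q₀) := extChartAt_target_mem_nhdsWithin (Φ q₀)
    rwa [nhdsWithin_eq_nhds.2 hrange] at h1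
  have hes_tendsto : Tendsto e.symm (𝓝 (ψ q₀)) (𝓝 (Φ q₀)) := by
    have := hesymm.continuousAt
    rwa [ContinuousAt, hsymm0] at this
  have hΦθ : ∀ᶠ y in 𝓝 (ψ q₀), Φ (θ y) = e.symm y := hes_tendsto.eventually hΨr
  have hψθ : ∀ᶠ y in 𝓝 (ψ q₀), ψ (θ y) = y := by
    filter_upwards [hΦθ, htgt] with y h1 h2
    simp only [hψdef, h1]
    exact e.right_inv h2
  have hθt : Tendsto θ (𝓝 (ψ q₀)) (𝓝 q₀) := by
    have := hθs.continuousAt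
    rwa [ContinuousAt, hθ0] at this
  have hθO : ∀ᶠ y in 𝓝 (ψ q₀), θ y ∈ O := hθt.eventually (hO.mem_nhds hq₀)
  -- `ρ` is smooth and positive near `q₀`
  have hdet0 : 0 < (gramMatrix I Φ q₀).det := gramOf_det_pos _ _ hinj
  have hdets : ContDiffAt ℝ ∞ (fun q => (gramMatrix I Φ q).det) q₀ := by
    simp only [Matrix.det_apply]
    have : ∀ i j, ContDiffAt ℝ ∞ (fun q => gramMatrix I Φ q i j) q₀ :=
      fun i j => (contDiffOn_gramMatrix hO hΦ i j).contDiffAt (hO.mem_nhds hq₀)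
    refine ContDiffAt.sum fun σ _ => ?_
    refine ContDiffAt.const_smul _ ?_
    exact contDiffAt_prod fun i _ => this _ _
  have hρdiff : DifferentiableAt ℝ ρ q₀ := (hdets.differentiableAt (by simp)).sqrt hdet0.ne'
  have hdetpos : ∀ᶠ q in 𝓝 q₀, 0 < (gramMatrix I Φ q).det :=
    hdets.continuousAt.eventually (lt_mem_nhds hdet0)
  have hw1 : DifferentiableAt ℝ (deriv w) (q₀ 0) := by
    have h1 := (hw.fderiv_right (m := 1) (by norm_num)).differentiableAt (by norm_num)
    exact h1.clm_apply (differentiableAt_const 1)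
  have hwev : ∀ᶠ q : 𝔼 in 𝓝 q₀, DifferentiableAt ℝ w (q 0) := by
    have h1 : ∀ᶠ t in 𝓝 (q₀ 0), DifferentiableAt ℝ w t :=
      (hw.eventually (by simp)).mono fun t ht => ht.differentiableAt (by norm_num)
    exact (EuclideanSpace.proj (0 : Fin (m + 1)) : 𝔼 →L[ℝ] ℝ).continuous.continuousAt.eventually h1
  have hrange' : ∀ᶠ y in 𝓝 (ψ q₀), Set.range I ∈ 𝓝 y := eventually_mem_nhds_iff.2 hrange
  have hθdiff : ∀ᶠ y in 𝓝 (ψ q₀), DifferentiableAt ℝ θ y := by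
    have := (hθs.of_le (m := 1) (by simp)).eventually (by simp)
    exact this.mono fun t ht => ht.differentiableAt (by norm_num)
  -- the function `u` in coordinates
  have hu : ∀ᶠ y in 𝓝 (ψ q₀), (u ∘ e.symm) y = w (θ y 0) := by
    filter_upwards [hΦθ, hθO] with y h1 h2
    rw [← huw _ h2, h1]
    rfl
  -- the relation between the metric in the chart and the adapted coordinates, near `ψ q₀`
  have hC : ∀ᶠ y in 𝓝 (ψ q₀), (stdMatrix (fderiv ℝ ψ (θ y))).transpose *
      metricMatrix I (Φ q₀) y * stdMatrix (fderiv ℝ ψ (θ y)) = gramMatrix I Φ (θ y) := by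
    filter_upwards [hΦθ, hψθ, hθO, htgt, hrange'] with y h1 h2 h3 h4 h5
    have h6 : extChartAt I (Φ q₀) (Φ (θ y)) = y := h2
    have h7 := gramMatrix_eq_metricMatrix (p := Φ q₀) (hΦ.contMDiffAt (hO.mem_nhds h3))
      (by rw [h1]; exact e.map_target h4) (by rwa [h6])
    rw [h6] at h7
    exact h7
  have hsub : ∀ {C B g : Matrix (Fin (m + 1)) (Fin (m + 1)) ℝ}, B.transpose * g * B = C →
      0 < C.det → B.det ≠ 0 ∧ g.det ≠ 0 := by
    intro C B g h1 h2
    rw [← h1, Matrix.det_mul, Matrix.det_mul, Matrix.det_transpose] at h2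
    constructor
    · intro h3; simp [h3] at h2
    · intro h3; simp [h3] at h2
  -- the weighted gradient of `u` is the push-forward of `ρ w' |det Dψ|⁻¹ ∂₀`
  have hX : ∀ k, (fun y => ∑ i, (metricMatrix I (Φ q₀) y)⁻¹ i k *
        √(metricMatrix I (Φ q₀) y).det * coordDeriv I (u ∘ e.symm) y i) =ᶠ[𝓝 (ψ q₀)]
      fun y => ρ (θ y) * deriv w (θ y 0) / |(stdMatrix (fderiv ℝ ψ (θ y))).det| *
        stdMatrix (fderiv ℝ ψ (θ y)) k 0 := by
    intro k
    filter_upwards [hC, hθO, hθt.eventually hdetpos, hu.eventually_nhds, hψθ.eventually_nhds,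
      hθdiff, hθt.eventually hwev, hrange', hψθ, hθt.eventually (eventually_eventually_nhds.2
        ((hψ.of_le (m := 1) (by simp)).eventually (by simp)))]
      with y h1 h2 h3 h4 h5 h6 h7 h8 h9 h10
    obtain ⟨hB, hg⟩ := hsub h1 h3
    refine sum_inv_mul_sqrt_det h1 ?_ (hrow _ h2) hB hg ?_ k
    · intro i j
      exact metricForm_comm (I := I) (e.symm y) _ _
    intro j
    -- the differential of `u` in coordinates, composed with `Dψ`, is `w' dq₀`
    have hψd : DifferentiableAt ℝ ψ (θ y) := h10.self_of_nhds.differentiableAt (by norm_num)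
    have hwθ : HasFDerivAt (fun z => w (θ z 0))
        ((deriv w (θ y 0)) • ((EuclideanSpace.proj (0 : Fin (m + 1)) : 𝔼 →L[ℝ] ℝ).comp
          (fderiv ℝ θ y))) y := by
      have a1 := ((EuclideanSpace.proj (0 : Fin (m + 1)) : 𝔼 →L[ℝ] ℝ).hasFDerivAt.comp y
        h6.hasFDerivAt)
      exact h7.hasDerivAt.comp_hasFDerivAt y a1
    have hcd : ∀ i, coordDeriv I (u ∘ e.symm) y i =
        deriv w (θ y 0) * fderiv ℝ θ y (EuclideanSpace.single i (1 : ℝ)) 0 := by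
      intro i
      rw [coordDeriv, fderivWithin_of_mem_nhds h8]
      have h4' : (u ∘ e.symm) =ᶠ[𝓝 y] fun z => w (θ z 0) := h4
      rw [h4'.fderiv_eq, hwθ.fderiv]
      simp
    have hTB : (fderiv ℝ ψ (θ y)).comp (fderiv ℝ θ y) = ContinuousLinearMap.id ℝ 𝔼 := by
      have a1 : HasFDerivAt (fun z => ψ (θ z)) ((fderiv ℝ ψ (θ y)).comp (fderiv ℝ θ y)) y :=
        hψd.hasFDerivAt.comp y h6.hasFDerivAt
      exact a1.unique ((hasFDerivAt_id y).congr_of_eventuallyEq h5)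
    have hTB2 : stdMatrix (fderiv ℝ θ y) * stdMatrix (fderiv ℝ ψ (θ y)) = 1 := by
      have := congrArg stdMatrix hTB
      rw [stdMatrix_comp, stdMatrix_id] at this
      exact mul_eq_one_comm.1 this
    have h11 := congrFun (congrFun hTB2 0) j
    rw [Matrix.mul_apply, Matrix.one_apply] at h11
    simp only [hcd, mul_assoc]
    rw [← Finset.mul_sum]
    have h12 : ∑ i, fderiv ℝ θ y (EuclideanSpace.single i (1 : ℝ)) 0 *
        stdMatrix (fderiv ℝ ψ (θ y)) i j = if 0 = j then 1 else 0 := h11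
    rw [h12]
    simp [eq_comm]
  -- the divergence
  have hh : DifferentiableAt ℝ (fun q : 𝔼 => ρ q * deriv w (q 0)) q₀ := by
    refine hρdiff.mul ?_
    exact DifferentiableAt.comp (g := deriv w) q₀ hw1
      (EuclideanSpace.proj (0 : Fin (m + 1)) : 𝔼 →L[ℝ] ℝ).differentiableAt
  have hh' : HasDerivAt (fun s : ℝ =>
      ρ (q₀ + s • EuclideanSpace.single 0 (1 : ℝ)) *
        deriv w ((q₀ + s • EuclideanSpace.single 0 (1 : ℝ) : 𝔼) 0))
      (ρ' * deriv w (q₀ 0) + ρ q₀ * deriv (deriv w) (q₀ 0)) 0 := by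
    have a1 : HasDerivAt (fun s : ℝ => (q₀ + s • EuclideanSpace.single 0 (1 : ℝ) : 𝔼) 0) 1 0 := by
      simpa using (hasDerivAt_id (0 : ℝ)).const_add (q₀ 0)
    have a2 : HasDerivAt (deriv w) (deriv (deriv w) (q₀ 0))
        ((q₀ + (0 : ℝ) • EuclideanSpace.single 0 (1 : ℝ) : 𝔼) 0) := by
      simpa using hw1.hasDerivAt
    have a3 := hρ'.mul (a2.comp (0 : ℝ) a1)
    exact a3.congr_deriv (by simp [hρdef])
  have hdiv := divergence_pushforward (ψ := ψ) (θ := θ) (q₀ := q₀) (hψ.of_le ENat.LEInfty.out)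
    (hθs.differentiableAt (by simp)) hθ0 hψθ hh hh'
  have hC0 := hC.self_of_nhds
  rw [hθ0] at hC0
  obtain ⟨hB0, hg0⟩ := hsub hC0 hdet0
  have hρ0 : ρ q₀ = |(stdMatrix (fderiv ℝ ψ q₀)).det| *
      √(metricMatrix I (Φ q₀) (ψ q₀)).det := by
    simp only [hρdef]
    rw [← hC0, Matrix.det_mul, Matrix.det_mul, Matrix.det_transpose, mul_right_comm, ← pow_two,
      Real.sqrt_mul (sq_nonneg _), Real.sqrt_sq_eq_abs]
  have hlap : laplaceBeltrami I u (Φ q₀) = (1 / √(metricMatrix I (Φ q₀) (ψ q₀)).det) *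
      ((ρ' * deriv w (q₀ 0) + ρ q₀ * deriv (deriv w) (q₀ 0)) /
        |(stdMatrix (fderiv ℝ ψ q₀)).det|) := by
    rw [laplaceBeltrami, ← hdiv]
    congr 1
    refine Finset.sum_congr rfl fun k _ => ?_
    rw [coordDeriv]
    change fderivWithin ℝ _ _ (ψ q₀) _ = _
    rw [fderivWithin_of_mem_nhds hrange, (hX k).fderiv_eq]
  rw [hlap, one_div_mul_eq_div, div_div, ← hρ0]

end Laplacian

/-! ### Slice coordinates along a normal curve -/

section Coordinates

variable {m : ℕ}

local notation "𝔼" => EuclideanSpace ℝ (Fin (m + 1))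
local notation "𝔽" => EuclideanSpace ℝ (Fin m)

/-- The projection `ℝᵐ⁺¹ → ℝᵐ` that forgets the coordinate `0`. -/
noncomputable def tailCoord : 𝔼 →L[ℝ] 𝔽 :=
  LinearMap.toContinuousLinearMap
    { toFun := fun q => WithLp.toLp 2 fun i : Fin m => q i.succ
      map_add' := fun _ _ => by ext; simp
      map_smul' := fun _ _ => by ext; simp }

/-- The inclusion `ℝᵐ → ℝᵐ⁺¹` onto the hyperplane on which the coordinate `0` vanishes. -/
noncomputable def inclTail : 𝔽 →L[ℝ] 𝔼 :=
  LinearMap.toContinuousLinearMap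
    { toFun := fun v => WithLp.toLp 2 (Fin.cons 0 fun i : Fin m => v i)
      map_add' := fun _ _ => by ext i; refine Fin.cases ?_ (fun j => ?_) i <;> simp
      map_smul' := fun _ _ => by ext i; refine Fin.cases ?_ (fun j => ?_) i <;> simp }

/-- The basis vector `∂₀` of `ℝᵐ⁺¹`. -/
noncomputable def headVector : 𝔼 := EuclideanSpace.single 0 (1 : ℝ)

@[simp] theorem tailCoord_apply (q : 𝔼) (i : Fin m) : tailCoord q i = q i.succ := rfl

@[simp] theorem inclTail_zero (v : 𝔽) : inclTail v 0 = 0 := rfl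

@[simp] theorem inclTail_succ (v : 𝔽) (i : Fin m) : inclTail v i.succ = v i := rfl

@[simp] theorem headVector_zero : (headVector : 𝔼) 0 = 1 := by simp [headVector]

@[simp] theorem tailCoord_headVector : tailCoord (headVector : 𝔼) = 0 := by ext; simp [headVector]

@[simp] theorem tailCoord_inclTail (v : 𝔽) : tailCoord (inclTail v) = v := by ext; simp

theorem eq_smul_headVector_add (q : 𝔼) : q = q 0 • headVector + inclTail (tailCoord q) := by
  ext i
  refine Fin.cases ?_ (fun j => ?_) i <;> simp [headVector]

theorem inclTail_single (i : Fin m) :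
    inclTail (EuclideanSpace.single i (1 : ℝ)) = EuclideanSpace.single i.succ (1 : ℝ) := by
  ext j
  refine Fin.cases ?_ (fun j => ?_) j <;> simp [(Fin.succ_ne_zero _).symm]

theorem Matrix.det_eq_of_col_zero {A : Matrix (Fin (m + 1)) (Fin (m + 1)) ℝ}
    (h : ∀ j, A j 0 = if j = 0 then 1 else 0) : A.det = (A.submatrix Fin.succ Fin.succ).det := by
  rw [Matrix.det_succ_column_zero, Finset.sum_eq_single 0]
  · simp [h]
  · intro j _ hj
    simp [h, hj]
  · simp

end Coordinates

section Slice

variable {m : ℕ} {H : Type*} [TopologicalSpace H]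
  {I : ModelWithCorners ℝ (EuclideanSpace ℝ (Fin (m + 1))) H}
  {M : Type*} [TopologicalSpace M] [ChartedSpace H M]
  [RiemannianBundle (fun x : M => TangentSpace I x)]
  {EG : Type*} [NormedAddCommGroup EG] [NormedSpace ℝ EG]
  {G : Type*} [TopologicalSpace G] [ChartedSpace EG G] [Group G]
  [MulAction G M]

local notation "𝔼" => EuclideanSpace ℝ (Fin (m + 1))
local notation "𝔽" => EuclideanSpace ℝ (Fin m)

variable (I) in
/-- The velocity vector of a curve. -/
noncomputable def velocity (c : ℝ → M) (t : ℝ) : 𝔼 := modelDeriv 𝓘(ℝ, ℝ) I c t (1 : ℝ)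

variable (I G) in
/-- The differential at the identity of the orbit map `g ↦ g • x`. -/
noncomputable def orbitDeriv (x : M) : EG →L[ℝ] 𝔼 :=
  modelDeriv 𝓘(ℝ, EG) I (fun g : G => g • x) 1

variable (I) in
/-- The differential at `x` of the action of `g`. -/
noncomputable def actDeriv (g : G) (x : M) : 𝔼 →L[ℝ] 𝔼 := modelDeriv I I (fun y : M => g • y) x

variable (EG G I) in
/-- A smooth unit speed curve in the interior of `M` whose velocity spans the orthogonal complement
of the tangent space of the orbit at each of its points. -/
structure IsNormalCurve (c : ℝ → M) (D : Set ℝ) : Prop where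
  isOpen : IsOpen D
  smooth : ContMDiffOn 𝓘(ℝ, ℝ) I ∞ c D
  interior : ∀ t ∈ D, I.IsInteriorPoint (c t)
  unit : ∀ t ∈ D, metricForm I (c t) (velocity I c t) (velocity I c t) = 1
  orth : ∀ t ∈ D, ∀ ξ : EG, metricForm I (c t) (velocity I c t) (orbitDeriv I G (c t) ξ) = 0
  span : ∀ t ∈ D, ∀ v : 𝔼, ∃ (a : ℝ) (ξ : EG), v = a • velocity I c t + orbitDeriv I G (c t) ξ

variable (EG) in
/-- A smooth map `η` from a neighbourhood `V` of the origin of `ℝᵐ` into `G` with `η 0 = 1`. -/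
structure IsLocalSlice (η : EuclideanSpace ℝ (Fin m) → G) (V : Set (EuclideanSpace ℝ (Fin m))) :
    Prop where
  isOpen : IsOpen V
  zero_mem : (0 : 𝔽) ∈ V
  smooth : ContMDiffOn 𝓘(ℝ, 𝔽) 𝓘(ℝ, EG) ∞ η V
  map_zero : η 0 = 1

/-- The coordinates `(t, v) ↦ η(v) • c(t)` adapted to the orbits near a point of the curve `c`. -/
noncomputable def sliceMap (η : 𝔽 → G) (c : ℝ → M) (q : 𝔼) : M := η (tailCoord q) • c (q 0)

variable {c : ℝ → M} {D : Set ℝ} {η : EuclideanSpace ℝ (Fin m) → G}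
  {V : Set (EuclideanSpace ℝ (Fin m))}

theorem IsIsometricAction.smooth_smul (hact : IsIsometricAction 𝓘(ℝ, EG) G I M) (g : G) :
    ContMDiff I I ∞ (fun x : M => g • x) :=
  hact.smooth.comp (contMDiff_const.prodMk contMDiff_id)

theorem IsIsometricAction.smooth_orbit (hact : IsIsometricAction 𝓘(ℝ, EG) G I M) (x : M) :
    ContMDiff 𝓘(ℝ, EG) I ∞ (fun g : G => g • x) :=
  hact.smooth.comp (contMDiff_id.prodMk contMDiff_const)

theorem IsIsometricAction.metricForm_actDeriv (hact : IsIsometricAction 𝓘(ℝ, EG) G I M) (g : G)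
    (x : M) (a b : 𝔼) :
    metricForm I (g • x) (actDeriv I g x a) (actDeriv I g x b) = metricForm I x a b :=
  hact.isometry g x a b

theorem IsIsometricAction.gramOf_actDeriv (hact : IsIsometricAction 𝓘(ℝ, EG) G I M) (g : G)
    (x : M) {k : ℕ} (L : EuclideanSpace ℝ (Fin k) →L[ℝ] 𝔼) :
    gramOf I (g • x) ((actDeriv I g x).comp L) = gramOf I x L := by
  ext i j
  exact hact.metricForm_actDeriv g x _ _

theorem IsIsometricAction.actDeriv_injective (hact : IsIsometricAction 𝓘(ℝ, EG) G I M) (g : G)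
    (x : M) : Function.Injective (actDeriv I g x) := by
  refine (injective_iff_map_eq_zero _).2 fun v hv => ?_
  refine eq_zero_of_metricForm_self (I := I) x v ?_
  rw [← hact.metricForm_actDeriv g, hv]
  simp

theorem velocity_smul (hact : IsIsometricAction 𝓘(ℝ, EG) G I M) (g : G) {t : ℝ}
    (hc : ContMDiffAt 𝓘(ℝ, ℝ) I ∞ c t) :
    velocity I (fun s => g • c s) t = actDeriv I g (c t) (velocity I c t) := by
  have := modelDeriv_comp (I := 𝓘(ℝ, ℝ)) (I' := I) (I'' := I) (g := fun y : M => g • y) (f := c)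
    (x := t) ((hact.smooth_smul g).mdifferentiable (by simp) _) (hc.mdifferentiableAt (by simp))
  exact congrArg (fun L : ℝ →L[ℝ] 𝔼 => L 1) this

/-- The differential at `v` of `v ↦ a(v) • x` takes values in the translate by `a(v)` of the tangent
space at `x` of the orbit of `x`. -/
theorem exists_modelDeriv_smul_eq [LieGroup 𝓘(ℝ, EG) ∞ G]
    (hact : IsIsometricAction 𝓘(ℝ, EG) G I M) {a : 𝔽 → G} {v : 𝔽}
    (ha : ContMDiffAt 𝓘(ℝ, 𝔽) 𝓘(ℝ, EG) ∞ a v) (x : M) (b : 𝔽) :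
    ∃ ξ : EG, modelDeriv 𝓘(ℝ, 𝔽) I (fun v' => a v' • x) v b =
      actDeriv I (a v) x (orbitDeriv I G x ξ) := by
  have h1 : ContMDiffAt 𝓘(ℝ, 𝔽) 𝓘(ℝ, EG) ∞ (fun v' => (a v)⁻¹ * a v') v :=
    contMDiffAt_const.mul ha
  have h2 : modelDeriv 𝓘(ℝ, 𝔽) I (fun v' => ((a v)⁻¹ * a v') • x) v =
      (modelDeriv 𝓘(ℝ, EG) I (fun g : G => g • x) ((a v)⁻¹ * a v)).comp
        (modelDeriv 𝓘(ℝ, 𝔽) 𝓘(ℝ, EG) (fun v' => (a v)⁻¹ * a v') v) :=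
    modelDeriv_comp ((hact.smooth_orbit x).mdifferentiable (by simp) _)
      (h1.mdifferentiableAt (by simp))
  have h3 : ContMDiffAt 𝓘(ℝ, 𝔽) I ∞ (fun v' => ((a v)⁻¹ * a v') • x) v :=
    ContMDiffAt.comp v ((hact.smooth_orbit x) _) h1
  have h4 : modelDeriv 𝓘(ℝ, 𝔽) I (fun v' => a v • (((a v)⁻¹ * a v') • x)) v =
      (modelDeriv I I (fun y : M => a v • y) (((a v)⁻¹ * a v) • x)).comp
        (modelDeriv 𝓘(ℝ, 𝔽) I (fun v' => ((a v)⁻¹ * a v') • x) v) :=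
    modelDeriv_comp ((hact.smooth_smul (a v)).mdifferentiable (by simp) _)
      (h3.mdifferentiableAt (by simp))
  rw [inv_mul_cancel] at h2
  rw [inv_mul_cancel, one_smul, h2] at h4
  simp only [smul_smul, mul_inv_cancel_left] at h4
  exact ⟨modelDeriv 𝓘(ℝ, 𝔽) 𝓘(ℝ, EG) (fun v' => (a v)⁻¹ * a v') v b, by rw [h4]; rfl⟩

theorem sliceMap_smul_headVector (hη : IsLocalSlice EG η V) (t : ℝ) :
    sliceMap η c (t • headVector : 𝔼) = c t := by
  simp [sliceMap, hη.map_zero]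

/-- The open set on which the slice coordinates are smooth. -/
def sliceDomain (D : Set ℝ) (V : Set 𝔽) : Set 𝔼 := {q | q 0 ∈ D ∧ tailCoord q ∈ V}

theorem isOpen_sliceDomain (hD : IsOpen D) (hV : IsOpen V) :
    IsOpen (sliceDomain D V) :=
  (hD.preimage (EuclideanSpace.proj (0 : Fin (m + 1)) : 𝔼 →L[ℝ] ℝ).continuous).inter
    (hV.preimage tailCoord.continuous)

theorem smul_headVector_mem_sliceDomain (hη : IsLocalSlice EG η V) {t : ℝ} (ht : t ∈ D) :
    (t • headVector : 𝔼) ∈ sliceDomain D V := by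
  refine ⟨by simpa using ht, ?_⟩
  simpa using hη.zero_mem

theorem contMDiffOn_sliceMap (hact : IsIsometricAction 𝓘(ℝ, EG) G I M)
    (hc : IsNormalCurve I EG G c D) (hη : IsLocalSlice EG η V) :
    ContMDiffOn 𝓘(ℝ, 𝔼) I ∞ (sliceMap η c) (sliceDomain D V) := by
  have h1 : ContMDiffOn 𝓘(ℝ, 𝔼) 𝓘(ℝ, EG) ∞ (fun q : 𝔼 => η (tailCoord q)) (sliceDomain D V) :=
    hη.smooth.comp tailCoord.contDiff.contMDiff.contMDiffOn (fun q hq => hq.2)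
  have h2 : ContMDiffOn 𝓘(ℝ, 𝔼) I ∞ (fun q : 𝔼 => c (q 0)) (sliceDomain D V) :=
    hc.smooth.comp
      (EuclideanSpace.proj (0 : Fin (m + 1)) : 𝔼 →L[ℝ] ℝ).contDiff.contMDiff.contMDiffOn
      (fun q hq => hq.1)
  exact hact.smooth.comp_contMDiffOn (h1.prodMk h2)

/-- The coordinate `t` of the slice map moves points along the translates `η(v) • c` of the curve
`c`. -/
theorem modelDeriv_sliceMap_headVector (hact : IsIsometricAction 𝓘(ℝ, EG) G I M)
    (hc : IsNormalCurve I EG G c D) (hη : IsLocalSlice EG η V) {q : 𝔼}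
    (hq : q ∈ sliceDomain D V) :
    modelDeriv 𝓘(ℝ, 𝔼) I (sliceMap η c) q headVector =
      actDeriv I (η (tailCoord q)) (c (q 0)) (velocity I c (q 0)) := by
  have hs := (contMDiffOn_sliceMap hact hc hη).contMDiffAt
    ((isOpen_sliceDomain hc.isOpen hη.isOpen).mem_nhds hq)
  rw [← velocity_smul hact _ (hc.smooth.contMDiffAt (hc.isOpen.mem_nhds hq.1))]
  have hline : HasFDerivAt (fun s : ℝ => s • headVector + inclTail (tailCoord q))
      ((ContinuousLinearMap.id ℝ ℝ).smulRight (headVector : 𝔼)) (q 0) :=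
    ((ContinuousLinearMap.id ℝ ℝ).smulRight (headVector : 𝔼)).hasFDerivAt.add_const _
  have hq' : q 0 • headVector + inclTail (tailCoord q) = q := (eq_smul_headVector_add q).symm
  have h1 := modelDeriv_comp (I := 𝓘(ℝ, ℝ)) (I' := 𝓘(ℝ, 𝔼)) (I'' := I) (g := sliceMap η c)
    (f := fun s : ℝ => s • headVector + inclTail (tailCoord q)) (x := q 0)
    (by rw [hq']; exact hs.mdifferentiableAt (by simp))
    hline.differentiableAt.mdifferentiableAt
  rw [hq', modelDeriv_eq_fderiv, hline.fderiv] at h1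
  have h2 : (fun s : ℝ => sliceMap η c (s • headVector + inclTail (tailCoord q))) =
      fun s => η (tailCoord q) • c s := by
    ext s
    simp [sliceMap]
  rw [h2] at h1
  have h3 := congrArg (fun L : ℝ →L[ℝ] 𝔼 => L 1) h1
  simpa [velocity] using h3.symm

theorem modelDeriv_sliceMap_inclTail (hact : IsIsometricAction 𝓘(ℝ, EG) G I M)
    (hc : IsNormalCurve I EG G c D) (hη : IsLocalSlice EG η V) {q : 𝔼}
    (hq : q ∈ sliceDomain D V) :
    (modelDeriv 𝓘(ℝ, 𝔼) I (sliceMap η c) q).comp inclTail =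
      modelDeriv 𝓘(ℝ, 𝔽) I (fun v => η v • c (q 0)) (tailCoord q) := by
  have hs := (contMDiffOn_sliceMap hact hc hη).contMDiffAt
    ((isOpen_sliceDomain hc.isOpen hη.isOpen).mem_nhds hq)
  have hline : HasFDerivAt (fun v : 𝔽 => q 0 • headVector + inclTail v) inclTail (tailCoord q) :=
    inclTail.hasFDerivAt.const_add _
  have hq' : q 0 • headVector + inclTail (tailCoord q) = q := (eq_smul_headVector_add q).symm
  have h1 := modelDeriv_comp (I := 𝓘(ℝ, 𝔽)) (I' := 𝓘(ℝ, 𝔼)) (I'' := I) (g := sliceMap η c)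
    (f := fun v : 𝔽 => q 0 • headVector + inclTail v) (x := tailCoord q)
    (by rw [hq']; exact hs.mdifferentiableAt (by simp))
    hline.differentiableAt.mdifferentiableAt
  rw [hq', modelDeriv_eq_fderiv, hline.fderiv] at h1
  have h2 : (fun v : 𝔽 => sliceMap η c (q 0 • headVector + inclTail v)) =
      fun v => η v • c (q 0) := by
    ext v
    simp [sliceMap]
  rw [h2] at h1
  exact h1.symm

/-- In slice coordinates the metric is `dt² + h`, with `h` a metric on the orbits. -/
theorem metricForm_sliceMap [LieGroup 𝓘(ℝ, EG) ∞ G] (hact : IsIsometricAction 𝓘(ℝ, EG) G I M)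
    (hc : IsNormalCurve I EG G c D) (hη : IsLocalSlice EG η V) {q : 𝔼}
    (hq : q ∈ sliceDomain D V) :
    metricForm I (sliceMap η c q) (modelDeriv 𝓘(ℝ, 𝔼) I (sliceMap η c) q headVector)
        (modelDeriv 𝓘(ℝ, 𝔼) I (sliceMap η c) q headVector) = 1 ∧
      ∀ b, metricForm I (sliceMap η c q) (modelDeriv 𝓘(ℝ, 𝔼) I (sliceMap η c) q headVector)
        (modelDeriv 𝓘(ℝ, 𝔼) I (sliceMap η c) q (inclTail b)) = 0 := by
  rw [modelDeriv_sliceMap_headVector hact hc hη hq]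
  refine ⟨(hact.metricForm_actDeriv _ _ _ _).trans (hc.unit _ hq.1), fun b => ?_⟩
  obtain ⟨ξ, hξ⟩ := exists_modelDeriv_smul_eq (m := m) hact
    (hη.smooth.contMDiffAt (hη.isOpen.mem_nhds hq.2)) (c (q 0)) b
  have h1 := congrArg (fun L : 𝔽 →L[ℝ] 𝔼 => L b) (modelDeriv_sliceMap_inclTail hact hc hη hq)
  simp only [ContinuousLinearMap.comp_apply] at h1
  rw [h1, hξ]
  exact (hact.metricForm_actDeriv _ _ _ _).trans (hc.orth _ hq.1 ξ)

theorem gramMatrix_sliceMap_col_zero [LieGroup 𝓘(ℝ, EG) ∞ G]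
    (hact : IsIsometricAction 𝓘(ℝ, EG) G I M)
    (hc : IsNormalCurve I EG G c D) (hη : IsLocalSlice EG η V) {q : 𝔼}
    (hq : q ∈ sliceDomain D V) (j : Fin (m + 1)) :
    gramMatrix I (sliceMap η c) q j 0 = if j = 0 then 1 else 0 := by
  obtain ⟨h1, h2⟩ := metricForm_sliceMap hact hc hη hq
  rw [gramMatrix_eq_gramOf, gramOf_isSymm]
  refine Fin.cases ?_ (fun i => ?_) j
  · simpa [gramOf, headVector] using h1
  · have := h2 (EuclideanSpace.single i 1)
    rw [inclTail_single] at this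
    simpa [gramOf, headVector, Fin.succ_ne_zero] using this

/-- By the block form of the metric, the slice coordinates have the same volume density as the
parametrization `v ↦ η(v) • c(t)` of the orbit. -/
theorem det_gramMatrix_sliceMap [LieGroup 𝓘(ℝ, EG) ∞ G]
    (hact : IsIsometricAction 𝓘(ℝ, EG) G I M)
    (hc : IsNormalCurve I EG G c D) (hη : IsLocalSlice EG η V) {t : ℝ} (ht : t ∈ D) :
    (gramMatrix I (sliceMap η c) (t • headVector : 𝔼)).det =
      (gramOf I (c t) (modelDeriv 𝓘(ℝ, 𝔽) I (fun v => η v • c t) 0)).det := by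
  have hq : (t • headVector : 𝔼) ∈ sliceDomain D V := smul_headVector_mem_sliceDomain hη ht
  rw [Matrix.det_eq_of_col_zero (gramMatrix_sliceMap_col_zero hact hc hη hq)]
  have h1 := modelDeriv_sliceMap_inclTail hact hc hη hq
  have h2 : (t • headVector : 𝔼) 0 = t := by simp
  have h3 : tailCoord (t • headVector : 𝔼) = 0 := by simp
  rw [h2, h3] at h1
  rw [← h1, gramMatrix_eq_gramOf, sliceMap_smul_headVector hη]
  congr 1
  ext i j
  simp [gramOf, inclTail_single]

end Slice

/-! ### Existence of slices and stabilizers along a normal curve -/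

section SliceExistence

variable {m : ℕ} {H : Type*} [TopologicalSpace H]
  {I : ModelWithCorners ℝ (EuclideanSpace ℝ (Fin (m + 1))) H}
  {M : Type*} [TopologicalSpace M] [ChartedSpace H M]
  [RiemannianBundle (fun x : M => TangentSpace I x)]
  {EG : Type*} [NormedAddCommGroup EG] [NormedSpace ℝ EG]
  {G : Type*} [TopologicalSpace G] [ChartedSpace EG G] [Group G] [LieGroup 𝓘(ℝ, EG) ∞ G]
  [MulAction G M]
  {c : ℝ → M} {D : Set ℝ} {η : EuclideanSpace ℝ (Fin m) → G}
  {V : Set (EuclideanSpace ℝ (Fin m))}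

local notation "𝔼" => EuclideanSpace ℝ (Fin (m + 1))
local notation "𝔽" => EuclideanSpace ℝ (Fin m)

theorem IsNormalCurve.finrank_range_orbitDeriv (hc : IsNormalCurve I EG G c D) {t : ℝ}
    (ht : t ∈ D) :
    Module.finrank ℝ (LinearMap.range (orbitDeriv (EG := EG) I G (c t)).toLinearMap) = m := by
  set R := LinearMap.range (orbitDeriv (EG := EG) I G (c t)).toLinearMap with hR
  have hv0 : velocity I c t ≠ 0 := by
    intro h
    have := hc.unit t ht
    rw [h] at this
    simp at this
  have hcompl : IsCompl (Submodule.span ℝ {velocity I c t}) R := by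
    rw [isCompl_iff]
    constructor
    · rw [Submodule.disjoint_def]
      intro x hx hx'
      obtain ⟨a, rfl⟩ := Submodule.mem_span_singleton.1 hx
      obtain ⟨ξ, hξ⟩ := hx'
      have h1 := hc.orth t ht ξ
      have h2 : orbitDeriv I G (c t) ξ = a • velocity I c t := hξ
      rw [h2, map_smul, hc.unit t ht] at h1
      have : a = 0 := by simpa using h1
      simp [this]
    · rw [codisjoint_iff, eq_top_iff]
      intro v _
      obtain ⟨a, ξ, rfl⟩ := hc.span t ht v
      exact Submodule.add_mem_sup (Submodule.smul_mem _ _ (Submodule.mem_span_singleton_self _))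
        ⟨ξ, rfl⟩
  have h1 := Submodule.finrank_add_eq_of_isCompl hcompl
  rw [finrank_span_singleton hv0, finrank_euclideanSpace_fin] at h1
  omega

/-- There is a local slice `η` such that `v ↦ η(v) • c(t)` is an immersion at the origin: in a chart
of `G`, it is the parametrization of a complement of the Lie algebra of the stabilizer. -/
theorem IsNormalCurve.exists_isLocalSlice (hact : IsIsometricAction 𝓘(ℝ, EG) G I M)
    (hc : IsNormalCurve I EG G c D) {t : ℝ} (ht : t ∈ D) :
    ∃ (η : EuclideanSpace ℝ (Fin m) → G) (V : Set (EuclideanSpace ℝ (Fin m))),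
      IsLocalSlice EG η V ∧
      Function.Injective (modelDeriv 𝓘(ℝ, 𝔽) I (fun v => η v • c t) 0) := by
  set e := extChartAt 𝓘(ℝ, EG) (1 : G) with he
  have htgt : e 1 ∈ e.target := mem_extChartAt_target (I := 𝓘(ℝ, EG)) (1 : G)
  have hopen : IsOpen e.target := isOpen_extChartAt_target (I := 𝓘(ℝ, EG)) (1 : G)
  set J : EG →L[ℝ] EG := modelDeriv 𝓘(ℝ, EG) 𝓘(ℝ, EG) e.symm (e 1) with hJ
  have hJsurj : Function.Surjective J := by
    have h1 := isInvertible_mfderivWithin_extChartAt_symm (I := 𝓘(ℝ, EG)) htgt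
    rw [ModelWithCorners.range_eq_univ, mfderivWithin_univ] at h1
    exact h1.surjective
  set L : EG →L[ℝ] 𝔼 := (orbitDeriv (EG := EG) I G (c t)).comp J with hL
  have hrange : LinearMap.range L.toLinearMap =
      LinearMap.range (orbitDeriv (EG := EG) I G (c t)).toLinearMap := by
    ext x
    constructor
    · rintro ⟨ξ, rfl⟩
      exact ⟨J ξ, rfl⟩
    · rintro ⟨ξ, rfl⟩
      obtain ⟨ζ, rfl⟩ := hJsurj ξ
      exact ⟨ζ, rfl⟩
  have hdim : Module.finrank ℝ (LinearMap.range L.toLinearMap) = m := by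
    rw [hrange]
    exact hc.finrank_range_orbitDeriv ht
  -- lift a basis of the tangent space of the orbit
  let φ : 𝔽 ≃ₗ[ℝ] LinearMap.range L.toLinearMap :=
    LinearEquiv.ofFinrankEq _ _ (by rw [hdim, finrank_euclideanSpace_fin])
  obtain ⟨s, hs⟩ := L.toLinearMap.rangeRestrict.exists_rightInverse_of_surjective
    L.toLinearMap.range_rangeRestrict
  set ℓ : 𝔽 →L[ℝ] EG := LinearMap.toContinuousLinearMap (s.comp φ.toLinearMap) with hℓ
  have hLℓ : Function.Injective (L.comp ℓ) := by
    intro a b hab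
    have key : ∀ a, L (ℓ a) = (φ a : 𝔼) := by
      intro a
      have := congrArg (fun T => ((T (φ a) : LinearMap.range L.toLinearMap) : 𝔼)) hs
      exact this
    have h1 : (φ a : 𝔼) = φ b := by
      rw [← key, ← key]
      exact hab
    exact φ.injective (Subtype.ext h1)
  have haff : ContDiff ℝ ∞ (fun v : 𝔽 => e 1 + ℓ v) := contDiff_const.add ℓ.contDiff
  have hslice : IsLocalSlice EG (fun v : 𝔽 => e.symm (e 1 + ℓ v)) {v | e 1 + ℓ v ∈ e.target} := by
    refine ⟨hopen.preimage haff.continuous, by simpa using htgt, ?_, ?_⟩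
    · exact (contMDiffOn_extChartAt_symm (1 : G)).comp haff.contMDiff.contMDiffOn (fun v hv => hv)
    · simp [he]
  refine ⟨_, _, hslice, ?_⟩
  have h0 : e 1 + ℓ (0 : 𝔽) = e 1 := by simp
  have hsymm : MDifferentiableAt 𝓘(ℝ, EG) 𝓘(ℝ, EG) e.symm (e 1) :=
    ((contMDiffOn_extChartAt_symm (n := ∞) (1 : G)).contMDiffAt
      (hopen.mem_nhds htgt)).mdifferentiableAt (by simp)
  have h1 : modelDeriv 𝓘(ℝ, 𝔽) 𝓘(ℝ, EG) (fun v : 𝔽 => e.symm (e 1 + ℓ v)) 0 = J.comp ℓ := by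
    have h2 := modelDeriv_comp (I := 𝓘(ℝ, 𝔽)) (I' := 𝓘(ℝ, EG)) (I'' := 𝓘(ℝ, EG)) (g := e.symm)
      (f := fun v : 𝔽 => e 1 + ℓ v) (x := 0) (by rwa [h0])
      (haff.contMDiff.mdifferentiable (by simp) _)
    rw [h2, h0, modelDeriv_eq_fderiv, (ℓ.hasFDerivAt.const_add (e 1)).fderiv]
  have h2 : modelDeriv 𝓘(ℝ, 𝔽) I (fun v : 𝔽 => e.symm (e 1 + ℓ v) • c t) 0 = L.comp ℓ := by
    have h3 := modelDeriv_comp (I := 𝓘(ℝ, 𝔽)) (I' := 𝓘(ℝ, EG)) (I'' := I)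
      (g := fun g : G => g • c t) (f := fun v : 𝔽 => e.symm (e 1 + ℓ v)) (x := 0)
      ((hact.smooth_orbit (c t)).mdifferentiable (by simp) _)
      ((hslice.smooth.contMDiffAt (hslice.isOpen.mem_nhds hslice.zero_mem)).mdifferentiableAt
        (by simp))
    have h4 : e.symm (e 1 + ℓ (0 : 𝔽)) = 1 := hslice.map_zero
    rw [h3, h1, h4]
    rfl
  rw [h2]
  exact hLℓ

theorem injective_modelDeriv_sliceMap (hact : IsIsometricAction 𝓘(ℝ, EG) G I M)
    (hc : IsNormalCurve I EG G c D) (hη : IsLocalSlice EG η V) {t : ℝ} (ht : t ∈ D)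
    (hinj : Function.Injective (modelDeriv 𝓘(ℝ, 𝔽) I (fun v => η v • c t) 0)) :
    Function.Injective (modelDeriv 𝓘(ℝ, 𝔼) I (sliceMap η c) (t • headVector)) := by
  refine injective_of_gramOf_det_ne_zero (I := I) (sliceMap η c (t • headVector : 𝔼)) _ ?_
  rw [← gramMatrix_eq_gramOf, det_gramMatrix_sliceMap hact hc hη ht]
  exact (gramOf_det_pos _ _ hinj).ne'

/-- Where `v ↦ η(v) • c(t)` is an immersion, the slice map has a smooth local inverse. -/
theorem exists_slice_inverse [IsManifold I ∞ M] (hact : IsIsometricAction 𝓘(ℝ, EG) G I M)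
    (hc : IsNormalCurve I EG G c D) (hη : IsLocalSlice EG η V) {t : ℝ} (ht : t ∈ D)
    (hinj : Function.Injective (modelDeriv 𝓘(ℝ, 𝔽) I (fun v => η v • c t) 0)) :
    ∃ Ψ : M → 𝔼, ContMDiffAt I 𝓘(ℝ, 𝔼) ∞ Ψ (c t) ∧ Ψ (c t) = t • headVector ∧
      ∀ᶠ y in 𝓝 (c t), sliceMap η c (Ψ y) = y := by
  have hs := (contMDiffOn_sliceMap hact hc hη).contMDiffAt
    ((isOpen_sliceDomain hc.isOpen hη.isOpen).mem_nhds (smul_headVector_mem_sliceDomain hη ht))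
  obtain ⟨Ψ, h1, h2, h3, -⟩ := exists_local_inverse hs
    (injective_modelDeriv_sliceMap hact hc hη ht hinj)
  rw [sliceMap_smul_headVector hη] at h1 h2 h3
  exact ⟨Ψ, h1, h2, h3⟩

end SliceExistence

section Stabilizer

variable {m : ℕ} {H : Type*} [TopologicalSpace H]
  {I : ModelWithCorners ℝ (EuclideanSpace ℝ (Fin (m + 1))) H}
  {M : Type*} [TopologicalSpace M] [ChartedSpace H M] [IsManifold I ∞ M]
  [RiemannianBundle (fun x : M => TangentSpace I x)]
  [IsContMDiffRiemannianBundle I ∞ (EuclideanSpace ℝ (Fin (m + 1)))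
    (fun x : M => TangentSpace I x)]
  {EG : Type*} [NormedAddCommGroup EG] [NormedSpace ℝ EG]
  {G : Type*} [TopologicalSpace G] [ChartedSpace EG G] [Group G] [LieGroup 𝓘(ℝ, EG) ∞ G]
  [MulAction G M]
  {c : ℝ → M} {D N : Set ℝ}

local notation "𝔼" => EuclideanSpace ℝ (Fin (m + 1))
local notation "𝔽" => EuclideanSpace ℝ (Fin m)

/-- An isometry `g ∈ G` that fixes a point of a normal curve fixes the nearby points as well,
provided that no two points of the curve lie on the same orbit. In slice coordinates `g • c` is a
curve `s ↦ (s, v(s))`; both `g • c` and `s ↦ (s, 0)` have unit speed and the metric is `dt² + h`,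
hence `v' = 0`. -/
theorem eventually_smul_eq (hact : IsIsometricAction 𝓘(ℝ, EG) G I M)
    (hc : IsNormalCurve I EG G c D) (hN : IsOpen N) (hND : N ⊆ D)
    (hdisj : ∀ (g : G), ∀ s ∈ N, ∀ s' ∈ N, g • c s = c s' → s = s') {t : ℝ} (ht : t ∈ N)
    {g : G} (hg : g • c t = c t) : ∀ᶠ s in 𝓝 t, g • c s = c s := by
  obtain ⟨η, V, hη, hinj⟩ := hc.exists_isLocalSlice hact (hND ht)
  obtain ⟨Ψ, hΨs, hΨ0, hΨ⟩ := exists_slice_inverse hact hc hη (hND ht) hinj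
  have hct : ∀ s ∈ D, ContMDiffAt 𝓘(ℝ, ℝ) I ∞ c s :=
    fun s hs => hc.smooth.contMDiffAt (hc.isOpen.mem_nhds hs)
  have hgc : ∀ s ∈ D, ContMDiffAt 𝓘(ℝ, ℝ) I ∞ (fun s => g • c s) s :=
    fun s hs => ContMDiffAt.comp s ((hact.smooth_smul g) _) (hct s hs)
  set q : ℝ → 𝔼 := fun s => Ψ (g • c s) with hq
  have hq0 : q t = t • headVector := by simp only [hq, hg, hΨ0]
  have hqs : ContDiffAt ℝ ∞ q t := by
    have h1 : ContMDiffAt I 𝓘(ℝ, 𝔼) ∞ Ψ (g • c t) := by rwa [hg]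
    exact (ContMDiffAt.comp t h1 (hgc t (hND ht))).contDiffAt
  have hqc : Tendsto q (𝓝 t) (𝓝 (t • headVector)) := by
    have := hqs.continuousAt
    rwa [ContinuousAt, hq0] at this
  have hgct : Tendsto (fun s => g • c s) (𝓝 t) (𝓝 (c t)) := by
    have := (hgc t (hND ht)).continuousAt
    rwa [ContinuousAt, hg] at this
  have ha : ∀ᶠ s in 𝓝 t, sliceMap η c (q s) = g • c s := hgct.eventually hΨ
  have hO := isOpen_sliceDomain hN hη.isOpen
  have hOD : sliceDomain N V ⊆ sliceDomain D V := fun q hq => ⟨hND hq.1, hq.2⟩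
  have hb : ∀ᶠ s in 𝓝 t, q s ∈ sliceDomain N V :=
    hqc.eventually (hO.mem_nhds (smul_headVector_mem_sliceDomain hη ht))
  have hcd : ∀ᶠ s in 𝓝 t, DifferentiableAt ℝ q s :=
    ((hqs.of_le (m := 1) (by simp)).eventually (by simp)).mono
      fun s hs => hs.differentiableAt (by norm_num)
  have hd : ∀ᶠ s in 𝓝 t,
      Function.Injective (modelDeriv 𝓘(ℝ, 𝔼) I (sliceMap η c) (q s)) := by
    have h1 : ContinuousAt (fun r => (gramMatrix I (sliceMap η c) r).det) (t • headVector : 𝔼) := by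
      have : ContinuousAt (fun r => gramMatrix I (sliceMap η c) r) (t • headVector : 𝔼) := by
        refine continuousAt_pi.2 fun i => continuousAt_pi.2 fun j => ?_
        exact (contDiffOn_gramMatrix hO ((contMDiffOn_sliceMap hact hc hη).mono hOD)
          i j).continuousOn.continuousAt (hO.mem_nhds (smul_headVector_mem_sliceDomain hη ht))
      exact (continuous_id.matrix_det.continuousAt).comp this
    have h2 : 0 < (gramMatrix I (sliceMap η c) (t • headVector : 𝔼)).det :=
      gramOf_det_pos _ _ (injective_modelDeriv_sliceMap hact hc hη (hND ht) hinj)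
    filter_upwards [hqc.eventually (h1.eventually (lt_mem_nhds h2))] with s hs
    exact injective_of_gramOf_det_ne_zero (I := I) _ _ hs.ne'
  -- the first slice coordinate of `g • c s` is `s`
  have hfirst : ∀ᶠ s in 𝓝 t, q s 0 = s := by
    filter_upwards [ha, hb, hN.mem_nhds ht] with s h1 h2 h3
    refine (hdisj ((η (tailCoord (q s)))⁻¹ * g) s h3 (q s 0) h2.1 ?_).symm
    rw [mul_smul, ← h1, sliceMap, inv_smul_smul]
  have hderiv : ∀ᶠ s in 𝓝 t, HasDerivAt (fun s => tailCoord (q s)) 0 s := by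
    filter_upwards [ha.eventually_nhds, hb, hcd, hd, hfirst.eventually_nhds, hN.mem_nhds ht]
      with s h1 h2 h3 h4 h5 h6
    have hmd := ((contMDiffOn_sliceMap hact hc hη).contMDiffAt
      ((isOpen_sliceDomain hc.isOpen hη.isOpen).mem_nhds (hOD h2))).mdifferentiableAt
      (n := ∞) (by simp)
    have hq' := h3.hasDerivAt
    have htail : HasDerivAt (fun s => tailCoord (q s)) (tailCoord (deriv q s)) s :=
      tailCoord.hasFDerivAt.comp_hasDerivAt s hq'
    have hhead : deriv q s 0 = 1 := by
      have e1 : HasDerivAt (fun s => q s 0) (deriv q s 0) s :=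
        (EuclideanSpace.proj (0 : Fin (m + 1)) : 𝔼 →L[ℝ] ℝ).hasFDerivAt.comp_hasDerivAt s hq'
      exact e1.unique ((hasDerivAt_id s).congr_of_eventuallyEq h5)
    have hsplit : deriv q s = headVector + inclTail (tailCoord (deriv q s)) := by
      conv_lhs => rw [eq_smul_headVector_add (deriv q s), hhead, one_smul]
    have hvel : modelDeriv 𝓘(ℝ, 𝔼) I (sliceMap η c) (q s) (deriv q s) =
        actDeriv I g (c s) (velocity I c s) := by
      rw [← velocity_smul hact g (hct s (hND h6))]
      have h7 : (fun s => sliceMap η c (q s)) =ᶠ[𝓝 s] fun s => g • c s := h1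
      have h8 := modelDeriv_comp (I := 𝓘(ℝ, ℝ)) (I' := 𝓘(ℝ, 𝔼)) (I'' := I)
        (g := sliceMap η c) (f := q) (x := s) hmd h3.mdifferentiableAt
      rw [h7.modelDeriv_eq, modelDeriv_eq_fderiv] at h8
      have h9 := congrArg (fun L : ℝ →L[ℝ] 𝔼 => L 1) h8
      exact h9.symm
    obtain ⟨hu, ho⟩ := metricForm_sliceMap hact hc hη (hOD h2)
    have hnorm : metricForm I (sliceMap η c (q s))
        (modelDeriv 𝓘(ℝ, 𝔼) I (sliceMap η c) (q s) (deriv q s))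
        (modelDeriv 𝓘(ℝ, 𝔼) I (sliceMap η c) (q s) (deriv q s)) = 1 := by
      rw [hvel, h1.self_of_nhds, hact.metricForm_actDeriv]
      exact hc.unit s (hND h6)
    set w := modelDeriv 𝓘(ℝ, 𝔼) I (sliceMap η c) (q s) (inclTail (tailCoord (deriv q s))) with hw
    have hzero : metricForm I (sliceMap η c (q s)) w w = 0 := by
      have hw' := ho (tailCoord (deriv q s))
      rw [← hw] at hw'
      rw [hsplit, map_add, ← hw] at hnorm
      simp only [map_add, LinearMap.add_apply] at hnorm
      rw [hu, hw', metricForm_comm _ w, hw'] at hnorm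
      linarith
    have hw0 := eq_zero_of_metricForm_self _ _ hzero
    have h7 : inclTail (tailCoord (deriv q s)) = 0 := h4 (by rw [← hw, hw0, map_zero])
    have h8 : tailCoord (deriv q s) = 0 := by
      rw [← tailCoord_inclTail (tailCoord (deriv q s)), h7, map_zero]
    rwa [h8] at htail
  obtain ⟨ε, hε, hball⟩ := Metric.eventually_nhds_iff_ball.1 (hderiv.and (ha.and hfirst))
  filter_upwards [Metric.ball_mem_nhds t hε] with s hs
  have hconst : tailCoord (q s) = tailCoord (q t) :=
    Metric.isOpen_ball.is_const_of_deriv_eq_zero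
      (convex_ball t ε).isPreconnected
      (fun r hr => (hball r hr).1.differentiableAt.differentiableWithinAt)
      (fun r hr => (hball r hr).1.deriv) hs (Metric.mem_ball_self hε)
  rw [hq0] at hconst
  obtain ⟨-, h1, h2⟩ := hball s hs
  rw [← h1, sliceMap, h2, hconst, map_smul, tailCoord_headVector, smul_zero, hη.map_zero, one_smul]

/-- All points of a normal curve have the same stabilizer, provided that no two of them lie on the
same orbit. -/
theorem smul_eq_of_smul_eq [T2Space M] (hact : IsIsometricAction 𝓘(ℝ, EG) G I M)
    (hc : IsNormalCurve I EG G c D) (hN : IsOpen N) (hNc : IsPreconnected N) (hND : N ⊆ D)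
    (hdisj : ∀ (g : G), ∀ s ∈ N, ∀ s' ∈ N, g • c s = c s' → s = s') {t s : ℝ} (ht : t ∈ N)
    (hs : s ∈ N) {g : G} (hg : g • c t = c t) : g • c s = c s := by
  have hcs : ContinuousOn c N := hc.smooth.continuousOn.mono hND
  have hgs : ContinuousOn (fun s => g • c s) N :=
    (hact.smooth_smul g).continuous.comp_continuousOn hcs
  set u : Set ℝ := {r | r ∈ N ∧ g • c r = c r} with hu
  have huo : IsOpen u := by
    rw [isOpen_iff_mem_nhds]
    rintro r ⟨hr, hgr⟩
    filter_upwards [hN.mem_nhds hr, eventually_smul_eq hact hc hN hND hdisj hr hgr] with r' h1 h2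
    exact ⟨h1, h2⟩
  have hsub : N ⊆ u := by
    refine hNc.subset_of_closure_inter_subset huo ⟨t, ht, ht, hg⟩ ?_
    rintro r ⟨hr, hrN⟩
    refine ⟨hrN, ?_⟩
    have : (𝓝[u] r).NeBot := mem_closure_iff_nhdsWithin_neBot.1 hr
    have h1 : Tendsto (fun s => g • c s) (𝓝[u] r) (𝓝 (g • c r)) :=
      (hgs.continuousAt (hN.mem_nhds hrN)).tendsto.mono_left nhdsWithin_le_nhds
    have h2 : Tendsto c (𝓝[u] r) (𝓝 (c r)) :=
      (hcs.continuousAt (hN.mem_nhds hrN)).tendsto.mono_left nhdsWithin_le_nhds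
    refine tendsto_nhds_unique h1 (h2.congr' ?_)
    filter_upwards [self_mem_nhdsWithin] with x hx
    exact hx.2.symm
  exact (hsub hs).2

end Stabilizer

/-! ### Comparison of the volumes of orbits -/

section Transport

variable {m : ℕ} {H : Type*} [TopologicalSpace H]
  {I : ModelWithCorners ℝ (EuclideanSpace ℝ (Fin (m + 1))) H}
  {M : Type*} [TopologicalSpace M] [ChartedSpace H M] [IsManifold I ∞ M]
  [RiemannianBundle (fun x : M => TangentSpace I x)]
  {EG : Type*} [NormedAddCommGroup EG] [NormedSpace ℝ EG]
  {G : Type*} [TopologicalSpace G] [ChartedSpace EG G] [Group G] [LieGroup 𝓘(ℝ, EG) ∞ G]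
  [MulAction G M]
  {c : ℝ → M} {D N : Set ℝ} {η : EuclideanSpace ℝ (Fin m) → G}
  {V : Set (EuclideanSpace ℝ (Fin m))} {t s : ℝ}

local notation "𝔼" => EuclideanSpace ℝ (Fin (m + 1))
local notation "𝔽" => EuclideanSpace ℝ (Fin m)

open Classical in
variable (G) in
/-- The map `g • c(t) ↦ g • c(s)` between the orbits of two points of a curve. It is well defined
where the two points have the same stabilizer, and is the identity off the orbit of `c(t)`. -/
noncomputable def orbitTransport (c : ℝ → M) (t s : ℝ) (x : M) : M :=
  if h : ∃ g : G, g • c t = x then h.choose • c s else x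

theorem orbitTransport_smul (hstab : ∀ g : G, g • c t = c t → g • c s = c s) (g : G) :
    orbitTransport G c t s (g • c t) = g • c s := by
  have h : ∃ g' : G, g' • c t = g • c t := ⟨g, rfl⟩
  rw [orbitTransport, dif_pos h]
  have h1 : (g⁻¹ * h.choose) • c t = c t := by rw [mul_smul, h.choose_spec, inv_smul_smul]
  have h2 := hstab _ h1
  rw [mul_smul, inv_smul_eq_iff] at h2
  exact h2

theorem injOn_orbitTransport (hst : ∀ g : G, g • c t = c t → g • c s = c s)
    (hts : ∀ g : G, g • c s = c s → g • c t = c t) :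
    Set.InjOn (orbitTransport G c t s) (MulAction.orbit G (c t)) := by
  rintro _ ⟨g, rfl⟩ _ ⟨g', rfl⟩ h
  simp only [orbitTransport_smul hst] at h
  have h1 : (g'⁻¹ * g) • c s = c s := by rw [mul_smul, h, inv_smul_smul]
  have h2 := hts _ h1
  rw [mul_smul, inv_smul_eq_iff] at h2
  exact h2

/-- The density at `c(t)` of the Riemannian measure of the orbit of `c(t)`, in the coordinates
`v ↦ η(v) • c(t)`. -/
noncomputable def orbitDensity (I : ModelWithCorners ℝ (EuclideanSpace ℝ (Fin (m + 1))) H)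
    [RiemannianBundle (fun x : M => TangentSpace I x)] (η : EuclideanSpace ℝ (Fin m) → G)
    (c : ℝ → M) (t : ℝ) : ℝ :=
  √(gramOf I (c t) (modelDeriv 𝓘(ℝ, 𝔽) I (fun v => η v • c t) 0)).det

/-- Near each of its points, the orbit of `c(t)` is parametrized by `v ↦ g • η(v) • c(t)`. The
orbit may return to the neighbourhood of the point only along itself, since no two points of the
curve lie on the same orbit. -/
theorem exists_orbit_coordinates (hact : IsIsometricAction 𝓘(ℝ, EG) G I M)
    (hc : IsNormalCurve I EG G c D) (hN : IsOpen N) (hND : N ⊆ D)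
    (hdisj : ∀ (g : G), ∀ r ∈ N, ∀ r' ∈ N, g • c r = c r' → r = r') (hη : IsLocalSlice EG η V)
    (ht : t ∈ N)
    (hinj : Function.Injective (modelDeriv 𝓘(ℝ, 𝔽) I (fun v => η v • c t) 0)) (g₀ : G) :
    ∃ a : M → EuclideanSpace ℝ (Fin m), ContMDiffAt I 𝓘(ℝ, 𝔽) ∞ a (g₀ • c t) ∧
      a (g₀ • c t) = 0 ∧
      ∀ᶠ x in 𝓝 (g₀ • c t), x ∈ MulAction.orbit G (c t) → x = g₀ • η (a x) • c t := by
  obtain ⟨Ψ, hΨs, hΨ0, hΨ⟩ := exists_slice_inverse hact hc hη (hND ht) hinj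
  have h0 : g₀⁻¹ • g₀ • c t = c t := inv_smul_smul _ _
  have hτ : ContMDiffAt I I ∞ (fun x : M => g₀⁻¹ • x) (g₀ • c t) := (hact.smooth_smul g₀⁻¹) _
  have hΨτ : ContMDiffAt I 𝓘(ℝ, 𝔼) ∞ (fun x : M => Ψ (g₀⁻¹ • x)) (g₀ • c t) := by
    have h1 : ContMDiffAt I 𝓘(ℝ, 𝔼) ∞ Ψ (g₀⁻¹ • g₀ • c t) := by rwa [h0]
    exact ContMDiffAt.comp (g₀ • c t) h1 hτ
  refine ⟨fun x => tailCoord (Ψ (g₀⁻¹ • x)), ?_, ?_, ?_⟩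
  · exact ContMDiffAt.comp (g₀ • c t) tailCoord.contDiff.contMDiff.contMDiffAt hΨτ
  · simp only [h0, hΨ0, map_smul, tailCoord_headVector, smul_zero]
  have hτt : Tendsto (fun x : M => g₀⁻¹ • x) (𝓝 (g₀ • c t)) (𝓝 (c t)) := by
    have := hτ.continuousAt
    rwa [ContinuousAt, h0] at this
  have hΨt : Tendsto (fun x : M => Ψ (g₀⁻¹ • x)) (𝓝 (g₀ • c t)) (𝓝 (t • headVector)) := by
    have := hΨτ.continuousAt
    rwa [ContinuousAt, h0, hΨ0] at this
  have hO := isOpen_sliceDomain hN hη.isOpen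
  filter_upwards [hτt.eventually hΨ,
    hΨt.eventually (hO.mem_nhds (smul_headVector_mem_sliceDomain hη ht))]
    with x h1 h2
  rintro ⟨g, rfl⟩
  simp only at h1 h2 ⊢
  have h3 : t = Ψ (g₀⁻¹ • g • c t) 0 := by
    refine hdisj ((η (tailCoord (Ψ (g₀⁻¹ • g • c t))))⁻¹ * g₀⁻¹ * g) t ht _ h2.1 ?_
    rw [mul_smul, mul_smul, inv_smul_eq_iff]
    exact h1.symm
  rw [sliceMap, ← h3] at h1
  rw [h1, smul_inv_smul]

theorem modelDeriv_orbit_coordinates (hact : IsIsometricAction 𝓘(ℝ, EG) G I M)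
    (hη : IsLocalSlice EG η V) (g₀ : G) {b : 𝔽 → 𝔽} {v₀ : 𝔽} (hb : ContDiffAt ℝ ∞ b v₀)
    (hb0 : b v₀ = 0) (x : M) :
    ContMDiffAt 𝓘(ℝ, 𝔽) I ∞ (fun v => g₀ • η (b v) • x) v₀ ∧
    modelDeriv 𝓘(ℝ, 𝔽) I (fun v => g₀ • η (b v) • x) v₀ =
      (actDeriv I g₀ x).comp
        ((modelDeriv 𝓘(ℝ, 𝔽) I (fun v => η v • x) 0).comp (fderiv ℝ b v₀)) := by
  have h1 : ContMDiffAt 𝓘(ℝ, 𝔽) I ∞ (fun v => η v • x) (b v₀) := by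
    rw [hb0]
    exact ContMDiffAt.comp (0 : 𝔽) ((hact.smooth_orbit x) _)
      (hη.smooth.contMDiffAt (hη.isOpen.mem_nhds hη.zero_mem))
  have h2 : ContMDiffAt 𝓘(ℝ, 𝔽) I ∞ (fun v => η (b v) • x) v₀ :=
    ContMDiffAt.comp v₀ h1 hb.contMDiffAt
  refine ⟨ContMDiffAt.comp v₀ ((hact.smooth_smul g₀) _) h2, ?_⟩
  have h3 := modelDeriv_comp (I := 𝓘(ℝ, 𝔽)) (I' := I) (I'' := I) (g := fun y : M => g₀ • y)
    (f := fun v => η (b v) • x) (x := v₀) ((hact.smooth_smul g₀).mdifferentiable (by simp) _)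
    (h2.mdifferentiableAt (by simp))
  have h4 := modelDeriv_comp (I := 𝓘(ℝ, 𝔽)) (I' := 𝓘(ℝ, 𝔽)) (I'' := I)
    (g := fun v => η v • x) (f := b) (x := v₀) (h1.mdifferentiableAt (by simp))
    (hb.contMDiffAt.mdifferentiableAt (n := ∞) (by simp))
  rw [h3, h4, hb0, hη.map_zero, one_smul, modelDeriv_eq_fderiv]
  rfl

/-- The transport between orbits maps parametrized pieces to parametrized pieces and multiplies
their volume densities by the constant `orbitDensity s / orbitDensity t`. -/
theorem IsParametrizedPiece.orbitTransport (hact : IsIsometricAction 𝓘(ℝ, EG) G I M)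
    (hc : IsNormalCurve I EG G c D) (hN : IsOpen N) (hND : N ⊆ D)
    (hdisj : ∀ (g : G), ∀ r ∈ N, ∀ r' ∈ N, g • c r = c r' → r = r') (hη : IsLocalSlice EG η V)
    (ht : t ∈ N)
    (hinjt : Function.Injective (modelDeriv 𝓘(ℝ, 𝔽) I (fun v => η v • c t) 0))
    (hinjs : Function.Injective (modelDeriv 𝓘(ℝ, 𝔽) I (fun v => η v • c s) 0))
    (hst : ∀ g : G, g • c t = c t → g • c s = c s)
    (hts : ∀ g : G, g • c s = c s → g • c t = c t)
    {ψ : 𝔽 → M} {U : Set 𝔽} (hψ : IsParametrizedPiece I ψ U (MulAction.orbit G (c t))) :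
    IsParametrizedPiece I (fun v => orbitTransport G c t s (ψ v)) U (MulAction.orbit G (c s)) ∧
    ∀ v ∈ U, √(gramMatrix I (fun v => _root_.orbitTransport G c t s (ψ v)) v).det *
      orbitDensity I η c t = √(gramMatrix I ψ v).det * orbitDensity I η c s := by
  have key : ∀ v₀ ∈ U, ContMDiffAt 𝓘(ℝ, 𝔽) I ∞
        (fun v => _root_.orbitTransport G c t s (ψ v)) v₀ ∧
      Function.Injective (modelDeriv 𝓘(ℝ, 𝔽) I
        (fun v => _root_.orbitTransport G c t s (ψ v)) v₀) ∧
      √(gramMatrix I (fun v => _root_.orbitTransport G c t s (ψ v)) v₀).det *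
        orbitDensity I η c t = √(gramMatrix I ψ v₀).det * orbitDensity I η c s := by
    intro v₀ hv₀
    obtain ⟨g₀, hg₀⟩ := hψ.mapsTo hv₀
    have hg₀' : ψ v₀ = g₀ • c t := hg₀.symm
    obtain ⟨a, has, ha0, ha⟩ :=
      exists_orbit_coordinates hact hc hN hND hdisj hη ht hinjt g₀
    rw [← hg₀'] at has ha0 ha
    have hψs : ContMDiffAt 𝓘(ℝ, 𝔽) I ∞ ψ v₀ :=
      hψ.contMDiffOn.contMDiffAt (hψ.isOpen.mem_nhds hv₀)
    have hbs : ContDiffAt ℝ ∞ (fun v => a (ψ v)) v₀ := (ContMDiffAt.comp v₀ has hψs).contDiffAt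
    have hloc : ψ =ᶠ[𝓝 v₀] fun v => g₀ • η (a (ψ v)) • c t := by
      filter_upwards [hψs.continuousAt.eventually ha, hψ.isOpen.mem_nhds hv₀] with v h1 h2
      exact h1 (hψ.mapsTo h2)
    have hloc' : (fun v => _root_.orbitTransport G c t s (ψ v)) =ᶠ[𝓝 v₀]
        fun v => g₀ • η (a (ψ v)) • c s := by
      filter_upwards [hloc] with v h1
      conv_lhs => rw [h1]
      rw [← mul_smul, orbitTransport_smul hst, mul_smul]
    obtain ⟨h1, h2⟩ := modelDeriv_orbit_coordinates hact hη g₀ hbs ha0 (c t)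
    obtain ⟨h3, h4⟩ := modelDeriv_orbit_coordinates hact hη g₀ hbs ha0 (c s)
    rw [← hloc.modelDeriv_eq] at h2
    rw [← hloc'.modelDeriv_eq] at h4
    have hbinj : Function.Injective (fderiv ℝ (fun v => a (ψ v)) v₀) := by
      have h5 : Function.Injective (modelDeriv 𝓘(ℝ, 𝔽) I ψ v₀) := hψ.immersion v₀ hv₀
      rw [h2] at h5
      exact (Function.Injective.of_comp (Function.Injective.of_comp h5))
    have hF0 : _root_.orbitTransport G c t s (ψ v₀) = g₀ • c s := by
      rw [hg₀', orbitTransport_smul hst]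
    refine ⟨h3.congr_of_eventuallyEq hloc', ?_, ?_⟩
    · rw [h4]
      exact (hact.actDeriv_injective g₀ _).comp (hinjs.comp hbinj)
    have hgram : ∀ {x : M} (r : ℝ), x = g₀ • c r → ∀ L : 𝔽 →L[ℝ] 𝔼,
        L = (actDeriv I g₀ (c r)).comp ((modelDeriv 𝓘(ℝ, 𝔽) I (fun v => η v • c r) 0).comp
          (fderiv ℝ (fun v => a (ψ v)) v₀)) →
        √(gramOf I x L).det =
          |(stdMatrix (fderiv ℝ (fun v => a (ψ v)) v₀)).det| * orbitDensity I η c r := by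
      rintro x r rfl L rfl
      rw [hact.gramOf_actDeriv, gramOf_comp, Matrix.det_mul, Matrix.det_mul,
        Matrix.det_transpose, mul_right_comm, ← pow_two, Real.sqrt_mul (sq_nonneg _),
        Real.sqrt_sq_eq_abs, orbitDensity]
    rw [gramMatrix_eq_gramOf, gramMatrix_eq_gramOf, hgram s hF0 _ h4, hgram t hg₀' _ h2]
    ring
  refine ⟨⟨hψ.isOpen, fun v hv => (key v hv).1.contMDiffWithinAt, ?_, fun v hv => (key v hv).2.1,
    ?_⟩, fun v hv => (key v hv).2.2⟩
  · intro v hv v' hv' h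
    exact hψ.injOn hv hv' (injOn_orbitTransport hst hts (hψ.mapsTo hv) (hψ.mapsTo hv') h)
  · intro v hv
    obtain ⟨g, hg⟩ := hψ.mapsTo hv
    have hg' : g • c t = ψ v := hg
    simp only [← hg', orbitTransport_smul hst]
    exact ⟨g, rfl⟩

/-- The volume of the orbit of `c(s)` is at least `orbitDensity s / orbitDensity t` times that of
the orbit of `c(t)`, since disjoint pieces of the latter are transported to disjoint pieces of the
former. Exchanging `t` and `s` gives equality. -/
theorem orbitVolume_mul_le (hact : IsIsometricAction 𝓘(ℝ, EG) G I M)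
    (hc : IsNormalCurve I EG G c D) (hN : IsOpen N) (hND : N ⊆ D)
    (hdisj : ∀ (g : G), ∀ r ∈ N, ∀ r' ∈ N, g • c r = c r' → r = r') (hη : IsLocalSlice EG η V)
    (ht : t ∈ N)
    (hinjt : Function.Injective (modelDeriv 𝓘(ℝ, 𝔽) I (fun v => η v • c t) 0))
    (hinjs : Function.Injective (modelDeriv 𝓘(ℝ, 𝔽) I (fun v => η v • c s) 0))
    (hst : ∀ g : G, g • c t = c t → g • c s = c s)
    (hts : ∀ g : G, g • c s = c s → g • c t = c t) :
    orbitVolume G I m (c t) * ENNReal.ofReal (orbitDensity I η c s) ≤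
      orbitVolume G I m (c s) * ENNReal.ofReal (orbitDensity I η c t) := by
  rw [orbitVolume, riemannianVolume]
  simp only [ENNReal.iSup_mul]
  refine iSup_le fun n => iSup_le fun ψ => iSup_le fun U => iSup_le fun hψ => iSup_le fun hd => ?_
  have hF : ∀ i, _ := fun i => (hψ i).orbitTransport hact hc hN hND hdisj hη ht hinjt hinjs hst hts
  have hvol : ∀ i, pieceVolume I (ψ i) (U i) * ENNReal.ofReal (orbitDensity I η c s) =
      pieceVolume I (fun v => orbitTransport G c t s (ψ i v)) (U i) *
        ENNReal.ofReal (orbitDensity I η c t) := by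
    intro i
    rw [pieceVolume, pieceVolume, ← MeasureTheory.lintegral_mul_const' _ _ ENNReal.ofReal_ne_top,
      ← MeasureTheory.lintegral_mul_const' _ _ ENNReal.ofReal_ne_top]
    refine MeasureTheory.setLIntegral_congr_fun (hψ i).isOpen.measurableSet fun v hv => ?_
    rw [← ENNReal.ofReal_mul (Real.sqrt_nonneg _), ← ENNReal.ofReal_mul (Real.sqrt_nonneg _),
      (hF i).2 v hv]
  rw [Finset.sum_mul, Finset.sum_congr rfl fun i _ => hvol i, ← Finset.sum_mul]
  refine mul_le_mul_left ?_ _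
  rw [orbitVolume, riemannianVolume]
  refine le_iSup_of_le n (le_iSup_of_le (fun i v => orbitTransport G c t s (ψ i v))
    (le_iSup_of_le U (le_iSup_of_le (fun i => (hF i).1) (le_iSup_of_le ?_ le_rfl))))
  intro i j hij
  rw [Set.disjoint_left]
  rintro _ ⟨v, hv, rfl⟩ ⟨v', hv', h⟩
  have h1 := injOn_orbitTransport hst hts ((hψ j).mapsTo hv') ((hψ i).mapsTo hv) h
  exact Set.disjoint_left.1 (hd hij) ⟨v, hv, rfl⟩ ⟨v', hv', h1⟩

end Transport

/-! ### The one-dimensional problem -/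

section OneDimensional

/-- A continuously differentiable function whose derivative does not vanish at `t` is injective
near `t`. -/
theorem exists_injOn_ball {w : ℝ → ℝ} {t : ℝ} {D : Set ℝ} (hD : D ∈ 𝓝 t)
    (hw : ContDiffAt ℝ 2 w t) (h : deriv w t ≠ 0) :
    ∃ ε > 0, Metric.ball t ε ⊆ D ∧ Set.InjOn w (Metric.ball t ε) := by
  have hdiff : ∀ᶠ s in 𝓝 t, DifferentiableAt ℝ w s :=
    (hw.eventually (by simp)).mono fun s hs => hs.differentiableAt (by norm_num)
  have hcont : ContinuousAt (deriv w) t := by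
    have h1 := (hw.fderiv_right (m := 1) (by norm_num)).continuousAt
    exact h1.clm_apply continuousAt_const
  obtain ⟨ε, hε, hball⟩ := Metric.eventually_nhds_iff_ball.1
    (hdiff.and ((hcont.eventually_ne h).and hD))
  refine ⟨ε, hε, fun s hs => (hball s hs).2.2, ?_⟩
  have key : ∀ a ∈ Metric.ball t ε, ∀ b ∈ Metric.ball t ε, a < b → w a ≠ w b := by
    intro a ha b hb hab hwab
    have hsub : Set.Icc a b ⊆ Metric.ball t ε := (convex_ball t ε).ordConnected.out ha hb
    obtain ⟨x, hx, hx'⟩ := exists_deriv_eq_zero hab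
      (fun s hs => (hball s (hsub hs)).1.continuousAt.continuousWithinAt) hwab
    exact (hball x (hsub (Set.Ioo_subset_Icc_self hx))).2.1 hx'
  intro a ha b hb hab
  rcases lt_trichotomy a b with h1 | h1 | h1
  · exact (key a ha b hb h1 hab).elim
  · exact h1
  · exact (key b hb a ha h1 hab.symm).elim

/-- If the flux `P = A w'` has nonpositive derivative wherever `w' ≠ 0`, then it is
nonincreasing. -/
theorem antitoneOn_flux {D : Set ℝ} {A w : ℝ → ℝ} (hD : IsOpen D) (hDc : D.OrdConnected)
    (hP : ∀ t ∈ D, DifferentiableAt ℝ (fun s => A s * deriv w s) t)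
    (hP' : ∀ t ∈ D, deriv w t ≠ 0 → deriv (fun s => A s * deriv w s) t ≤ 0) :
    AntitoneOn (fun s => A s * deriv w s) D := by
  set P : ℝ → ℝ := fun s => A s * deriv w s with hPdef
  have hcont : ContinuousOn P D := fun t ht => (hP t ht).continuousAt.continuousWithinAt
  refine antitoneOn_of_deriv_nonpos hDc.convex hcont
    (fun t ht => (hP t (interior_subset ht)).differentiableWithinAt) fun t ht => ?_
  rw [hD.interior_eq] at ht
  by_cases hw : deriv w t = 0
  swap
  · exact hP' t ht hw
  by_contra! hpos
  -- if `P' > 0` at a zero of `w'`, then `P > 0` and hence `P' ≤ 0` to the right of it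
  have hP0 : P t = 0 := by simp [hPdef, hw]
  have h1 : ∀ᶠ s in 𝓝[>] t, 0 < P s := by
    have h2 := (hasDerivAt_iff_tendsto_slope.1 (hP t ht).hasDerivAt).eventually (lt_mem_nhds hpos)
    have h3 : ∀ᶠ s in 𝓝[>] t, 0 < slope P t s :=
      h2.filter_mono (nhdsWithin_mono _ fun s hs => ne_of_gt hs)
    filter_upwards [h3, self_mem_nhdsWithin] with s hs hs'
    rw [slope_def_field, hP0, sub_zero] at hs
    exact (div_pos_iff_of_pos_right (sub_pos.2 hs')).1 hs
  obtain ⟨b, hb, hbP⟩ := mem_nhdsGT_iff_exists_Ioc_subset.1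
    (h1.and (mem_nhdsWithin_of_mem_nhds (hD.mem_nhds ht)))
  have hbD : b ∈ D := (hbP ⟨hb, le_rfl⟩).2
  have hsub : Set.Icc t b ⊆ D := hDc.out ht hbD
  have hanti : AntitoneOn P (Set.Icc t b) := by
    refine antitoneOn_of_deriv_nonpos (convex_Icc t b) (hcont.mono hsub)
      (fun s hs => (hP s (hsub (interior_subset hs))).differentiableWithinAt) fun s hs => ?_
    rw [interior_Icc] at hs
    refine hP' s (hsub (Set.Ioo_subset_Icc_self hs)) fun h0 => ?_
    have := (hbP ⟨hs.1, hs.2.le⟩).1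
    simp [hPdef, h0] at this
  have hbt : t < b := hb
  have h2 := hanti (Set.left_mem_Icc.2 hbt.le) (Set.right_mem_Icc.2 hbt.le) hbt.le
  have h3 : 0 < P b := (hbP ⟨hb, le_rfl⟩).1
  rw [hP0] at h2
  linarith

/-- In terms of the variable `J`, the function `w` is concave on all of `ℝ`. If it is nonnegative,
it is therefore constant. -/
theorem deriv_eq_zero_of_antitoneOn_flux {D : Set ℝ} {A w J : ℝ → ℝ} (hDc : D.OrdConnected)
    (hA : ∀ t ∈ D, 0 < A t) (hw : ∀ t ∈ D, DifferentiableAt ℝ w t) (hw0 : ∀ t ∈ D, 0 ≤ w t)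
    (hJ : ∀ t ∈ D, HasDerivAt J (A t)⁻¹ t) (hsurj : Set.SurjOn J D Set.univ)
    (hP : AntitoneOn (fun s => A s * deriv w s) D) {t : ℝ} (ht : t ∈ D) : deriv w t = 0 := by
  have hJmono : MonotoneOn J D := by
    refine monotoneOn_of_deriv_nonneg hDc.convex
      (fun s hs => (hJ s hs).continuousAt.continuousWithinAt)
      (fun s hs => (hJ s (interior_subset hs)).differentiableAt.differentiableWithinAt) ?_
    intro s hs
    rw [(hJ s (interior_subset hs)).deriv]
    exact (inv_pos.2 (hA s (interior_subset hs))).le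
  by_contra hne
  set p := A t * deriv w t with hp
  have hp0 : p ≠ 0 := mul_ne_zero (hA t ht).ne' hne
  -- the point at which the affine bound `w t + p (J - J t)` equals `-1`
  obtain ⟨s, hs, hJs⟩ := hsurj (Set.mem_univ (J t - (w t + 1) / p))
  have hd : ∀ r ∈ D, HasDerivAt (fun r => w r - p * J r) (deriv w r - p * (A r)⁻¹) r :=
    fun r hr => (hw r hr).hasDerivAt.sub ((hJ r hr).const_mul p)
  have hdeq : ∀ r ∈ D, deriv w r - p * (A r)⁻¹ = (A r * deriv w r - p) / A r := by
    intro r hr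
    have := (hA r hr).ne'
    field_simp
  have hwt := hw0 t ht
  have hws := hw0 s hs
  have hfin : w s - p * J s ≤ w t - p * J t → False := by
    intro h
    rw [hJs, mul_sub, mul_div_cancel₀ _ hp0] at h
    linarith
  rcases lt_or_gt_of_ne hp0 with hneg | hpos
  · have hts : t ≤ s := by
      by_contra! hst
      have h1 := hJmono hs ht hst.le
      have h2 : (w t + 1) / p < 0 := div_neg_of_pos_of_neg (by linarith) hneg
      rw [hJs] at h1
      linarith
    have hsub : Set.Icc t s ⊆ D := hDc.out ht hs
    have hmono : AntitoneOn (fun r => w r - p * J r) (Set.Icc t s) := by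
      refine antitoneOn_of_deriv_nonpos (convex_Icc t s)
        (fun r hr => (hd r (hsub hr)).continuousAt.continuousWithinAt)
        (fun r hr => (hd r (hsub (interior_subset hr))).differentiableAt.differentiableWithinAt) ?_
      intro r hr
      have hr' := interior_subset hr
      rw [(hd r (hsub hr')).deriv, hdeq r (hsub hr')]
      have h1 : A r * deriv w r ≤ p := hP ht (hsub hr') hr'.1
      exact div_nonpos_of_nonpos_of_nonneg (by linarith) (hA r (hsub hr')).le
    exact hfin (hmono (Set.left_mem_Icc.2 hts) (Set.right_mem_Icc.2 hts) hts)
  · have hst : s ≤ t := by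
      by_contra! hts
      have h1 := hJmono ht hs hts.le
      have h2 : 0 < (w t + 1) / p := div_pos (by linarith) hpos
      rw [hJs] at h1
      linarith
    have hsub : Set.Icc s t ⊆ D := hDc.out hs ht
    have hmono : MonotoneOn (fun r => w r - p * J r) (Set.Icc s t) := by
      refine monotoneOn_of_deriv_nonneg (convex_Icc s t)
        (fun r hr => (hd r (hsub hr)).continuousAt.continuousWithinAt)
        (fun r hr => (hd r (hsub (interior_subset hr))).differentiableAt.differentiableWithinAt) ?_
      intro r hr
      have hr' := interior_subset hr
      rw [(hd r (hsub hr')).deriv, hdeq r (hsub hr')]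
      have h1 : p ≤ A r * deriv w r := hP (hsub hr') ht hr'.2
      exact div_nonneg (by linarith) (hA r (hsub hr')).le
    exact hfin (hmono (Set.left_mem_Icc.2 hst) (Set.right_mem_Icc.2 hst) hst)

end OneDimensional

section RadialLaplacian

variable {m : ℕ} {H : Type*} [TopologicalSpace H]
  {I : ModelWithCorners ℝ (EuclideanSpace ℝ (Fin (m + 1))) H}
  {M : Type*} [TopologicalSpace M] [ChartedSpace H M] [IsManifold I ∞ M] [T2Space M]
  [RiemannianBundle (fun x : M => TangentSpace I x)]
  [IsContMDiffRiemannianBundle I ∞ (EuclideanSpace ℝ (Fin (m + 1)))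
    (fun x : M => TangentSpace I x)]
  {EG : Type*} [NormedAddCommGroup EG] [NormedSpace ℝ EG]
  {G : Type*} [TopologicalSpace G] [ChartedSpace EG G] [Group G] [LieGroup 𝓘(ℝ, EG) ∞ G]
  [MulAction G M]
  {c : ℝ → M} {D : Set ℝ} {u : M → ℝ}

local notation "𝔼" => EuclideanSpace ℝ (Fin (m + 1))
local notation "𝔽" => EuclideanSpace ℝ (Fin m)

/-- The Laplacian of a radial function in terms of the orbit volumes: `A Δu = (A w')'`, where
`w = u ∘ c`, at the points where `w'` does not vanish. -/
theorem hasDerivAt_orbitVolume_mul_deriv (hact : IsIsometricAction 𝓘(ℝ, EG) G I M)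
    (hc : IsNormalCurve I EG G c D)
    (hw : ContDiffOn ℝ 2 (fun t => u (c t)) D) (hu : ∀ (g : G), ∀ t ∈ D, u (g • c t) = u (c t))
    {t : ℝ} (ht : t ∈ D) (hne : deriv (fun t => u (c t)) t ≠ 0) :
    HasDerivAt (fun s => (orbitVolume G I m (c s)).toReal * deriv (fun t => u (c t)) s)
      ((orbitVolume G I m (c t)).toReal * laplaceBeltrami I u (c t)) t := by
  set w : ℝ → ℝ := fun t => u (c t) with hwdef
  have hwt : ContDiffAt ℝ 2 w t := hw.contDiffAt (hc.isOpen.mem_nhds ht)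
  obtain ⟨ε, hε, hND, hinjw⟩ := exists_injOn_ball (hc.isOpen.mem_nhds ht) hwt hne
  set N := Metric.ball t ε with hNdef
  have hN : IsOpen N := Metric.isOpen_ball
  have hNc : IsPreconnected N := (convex_ball t ε).isPreconnected
  have htN : t ∈ N := Metric.mem_ball_self hε
  -- `w` separates the orbits of the points of `c` near `c t`
  have hdisj : ∀ (g : G), ∀ r ∈ N, ∀ r' ∈ N, g • c r = c r' → r = r' := by
    intro g r hr r' hr' h
    refine hinjw hr hr' ?_
    simp only [hwdef]
    rw [← h, hu g r (hND hr)]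
  have hstab : ∀ r ∈ N, ∀ r' ∈ N, ∀ g : G, g • c r = c r → g • c r' = c r' :=
    fun r hr r' hr' g hg => smul_eq_of_smul_eq hact hc hN hNc hND hdisj hr hr' hg
  obtain ⟨η, V, hη, hinj⟩ := hc.exists_isLocalSlice hact ht
  have hO : IsOpen (sliceDomain (m := m) N V) := isOpen_sliceDomain hN hη.isOpen
  have hOD : sliceDomain (m := m) N V ⊆ sliceDomain D V := fun q hq => ⟨hND hq.1, hq.2⟩
  have hq₀ : (t • headVector : 𝔼) ∈ sliceDomain N V := smul_headVector_mem_sliceDomain hη htN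
  have hΦ := (contMDiffOn_sliceMap hact hc hη).mono hOD
  have hinjΦ := injective_modelDeriv_sliceMap hact hc hη ht hinj
  set ρ : ℝ → ℝ := orbitDensity I η c with hρ
  have hρeq : ∀ r ∈ D, √(gramMatrix I (sliceMap η c) (r • headVector : 𝔼)).det = ρ r := by
    intro r hr
    rw [det_gramMatrix_sliceMap hact hc hη hr]
    rfl
  have hρt : 0 < ρ t := Real.sqrt_pos.2 (gramOf_det_pos _ _ hinj)
  have hρdiff : DifferentiableAt ℝ ρ t := by
    have h1 : DifferentiableAt ℝ
        (fun r : ℝ => (gramMatrix I (sliceMap η c) (r • headVector : 𝔼)).det) t := by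
      have h2 : ∀ i j, DifferentiableAt ℝ
          (fun r : ℝ => gramMatrix I (sliceMap η c) (r • headVector : 𝔼) i j) t := by
        intro i j
        have h3 := ((contDiffOn_gramMatrix hO hΦ i j).contDiffAt
          (hO.mem_nhds hq₀)).differentiableAt (by simp)
        exact DifferentiableAt.comp (g := fun q => gramMatrix I (sliceMap η c) q i j) t h3
          (differentiableAt_id.smul_const headVector)
      simp only [Matrix.det_apply]
      fun_prop
    have h2 : (gramMatrix I (sliceMap η c) (t • headVector : 𝔼)).det ≠ 0 :=
      (gramOf_det_pos _ _ hinjΦ).ne'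
    refine (h1.sqrt h2).congr_of_eventuallyEq ?_
    filter_upwards [hc.isOpen.mem_nhds ht] with r hr
    exact (hρeq r hr).symm
  have hρpos : ∀ᶠ r in 𝓝 t, 0 < ρ r := hρdiff.continuousAt.eventually (lt_mem_nhds hρt)
  -- `A` is a constant multiple of the density `ρ` near `t`
  have hvol : ∀ᶠ r in 𝓝 t, (orbitVolume G I m (c r)).toReal =
      (orbitVolume G I m (c t)).toReal / ρ t * ρ r := by
    filter_upwards [hρpos, hN.mem_nhds htN] with r h1 h2
    have hinjr : Function.Injective (modelDeriv 𝓘(ℝ, 𝔽) I (fun v => η v • c r) 0) :=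
      injective_of_gramOf_det_ne_zero (I := I) (c r) _ (Real.sqrt_pos.1 h1).ne'
    have h3 := le_antisymm
      (orbitVolume_mul_le hact hc hN hND hdisj hη htN hinj hinjr (hstab t htN r h2)
        (hstab r h2 t htN))
      (orbitVolume_mul_le hact hc hN hND hdisj hη h2 hinjr hinj (hstab r h2 t htN)
        (hstab t htN r h2))
    have h4 := congrArg ENNReal.toReal h3
    rw [ENNReal.toReal_mul, ENNReal.toReal_mul, ENNReal.toReal_ofReal h1.le,
      ENNReal.toReal_ofReal hρt.le] at h4
    rw [div_mul_eq_mul_div, eq_div_iff hρt.ne']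
    exact h4.symm
  -- the Laplacian in slice coordinates
  have hrow : ∀ q ∈ sliceDomain (m := m) N V, ∀ j, gramMatrix I (sliceMap η c) q j 0 =
      if j = 0 then 1 else 0 :=
    fun q hq j => gramMatrix_sliceMap_col_zero hact hc hη (hOD hq) j
  have hcoord : (t • headVector : 𝔼) 0 = t := by simp
  have hsm : sliceMap η c (t • headVector : 𝔼) = c t := sliceMap_smul_headVector hη t
  have hρ' : HasDerivAt (fun s : ℝ => √(gramMatrix I (sliceMap η c)
      ((t • headVector : 𝔼) + s • EuclideanSpace.single 0 (1 : ℝ))).det) (deriv ρ t) 0 := by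
    have h1 : HasDerivAt (fun s : ℝ => ρ (t + s)) (deriv ρ t) 0 := by
      have h2 : HasDerivAt ρ (deriv ρ t) (t + 0) := by simpa using hρdiff.hasDerivAt
      exact h2.comp_const_add t 0
    refine h1.congr_of_eventuallyEq ?_
    have h3 : ∀ᶠ s in 𝓝 (0 : ℝ), t + s ∈ D := by
      have : ContinuousAt (fun s : ℝ => t + s) 0 := by fun_prop
      exact this.eventually (by simpa using hc.isOpen.mem_nhds ht)
    filter_upwards [h3] with s hs
    rw [← hρeq _ hs, add_smul]
    rfl
  have hlap := laplaceBeltrami_eq (u := u) (w := w) hO hq₀ hΦ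
    (by rw [hsm]; exact hc.interior t ht) hinjΦ hrow (by rwa [hcoord])
    (fun q hq => hu _ _ (hND hq.1)) hρ'
  rw [hsm, hcoord, hρeq t ht] at hlap
  have hw1 : DifferentiableAt ℝ (deriv w) t := by
    have h1 := (hwt.fderiv_right (m := 1) (by norm_num)).differentiableAt (by norm_num)
    exact h1.clm_apply (differentiableAt_const 1)
  have hprod : HasDerivAt (fun r => (orbitVolume G I m (c t)).toReal / ρ t * (ρ r * deriv w r))
      ((orbitVolume G I m (c t)).toReal / ρ t *
        (deriv ρ t * deriv w t + ρ t * deriv (deriv w) t)) t :=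
    (hρdiff.hasDerivAt.mul hw1.hasDerivAt).const_mul _
  have hval : (orbitVolume G I m (c t)).toReal * laplaceBeltrami I u (c t) =
      (orbitVolume G I m (c t)).toReal / ρ t *
        (deriv ρ t * deriv w t + ρ t * deriv (deriv w) t) := by
    rw [hlap]
    ring
  rw [hval]
  refine hprod.congr_of_eventuallyEq ?_
  filter_upwards [hvol] with r hr
  rw [hr, mul_assoc]

end RadialLaplacian

/-! ### Normal curves from sections, and the Liouville theorem -/

section Section

variable {m : ℕ} {H : Type*} [TopologicalSpace H]
  {I : ModelWithCorners ℝ (EuclideanSpace ℝ (Fin (m + 1))) H}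
  {M : Type*} [TopologicalSpace M] [ChartedSpace H M]
  [RiemannianBundle (fun x : M => TangentSpace I x)]
  {EG : Type*} [NormedAddCommGroup EG] [NormedSpace ℝ EG]
  {G : Type*} [TopologicalSpace G] [ChartedSpace EG G] [Group G]
  [MulAction G M]
  {HS : Type*} [TopologicalSpace HS] {IS : ModelWithCorners ℝ (EuclideanSpace ℝ (Fin 1)) HS}
  {S : Type*} [TopologicalSpace S] [ChartedSpace HS S] {ι : S → M} {γ : ℝ → S} {D : Set ℝ}

local notation "𝔼" => EuclideanSpace ℝ (Fin (m + 1))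

/-- Tangent spaces at equal points have the same underlying model space, and transport along the
equality of the points is the identity on it. -/
theorem transport_tangentSpace {x y : M} (h : y = x) (R : Submodule ℝ (TangentSpace I y)) (v : 𝔼) :
    (v : TangentSpace I x) ∈ (h ▸ R : Submodule ℝ (TangentSpace I x)) ↔
      (v : TangentSpace I y) ∈ R := by
  subst h
  rfl

theorem mem_orbitTangentSpace_iff (x : M) (v : 𝔼) :
    (v : TangentSpace I x) ∈ orbitTangentSpace 𝓘(ℝ, EG) G I x ↔
      ∃ ξ : EG, orbitDeriv I G x ξ = v :=
  transport_tangentSpace (one_smul G x) _ v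

/-- Parametrized by arclength, the regular part of a section is a normal curve. -/
theorem IsPolarSection.isNormalCurve (hpolar : IsPolarSection 𝓘(ℝ, EG) G I IS ι)
    (hγ : IsArclengthParametrization G I IS ι γ D) :
    IsNormalCurve I EG G (fun t => ι (γ t)) D := by
  have hmem : ∀ t ∈ D, γ t ∈ regularPart G I ι := fun t ht => hγ.bijOn.mapsTo ht
  have hγt : ∀ t ∈ D, MDifferentiableAt 𝓘(ℝ, ℝ) IS γ t := fun t ht =>
    (hγ.smooth.contMDiffAt (hγ.isOpen.mem_nhds ht)).mdifferentiableAt (by simp)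
  have hvel : ∀ t ∈ D, velocity I (fun t => ι (γ t)) t =
      modelDeriv IS I ι (γ t) (modelDeriv 𝓘(ℝ, ℝ) IS γ t 1) := by
    intro t ht
    have := modelDeriv_comp (I := 𝓘(ℝ, ℝ)) (I' := IS) (I'' := I) (g := ι) (f := γ) (x := t)
      (hpolar.smooth.mdifferentiable (by simp) _) (hγt t ht)
    exact congrArg (fun L : ℝ →L[ℝ] 𝔼 => L 1) this
  have hunit : ∀ t ∈ D, metricForm I (ι (γ t)) (velocity I (fun t => ι (γ t)) t)
      (velocity I (fun t => ι (γ t)) t) = 1 := by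
    intro t ht
    have h1 := hγ.unit_speed t ht
    have h2 := real_inner_self_eq_norm_sq (F := TangentSpace I ((ι ∘ γ) t))
      (mfderiv 𝓘(ℝ, ℝ) I (ι ∘ γ) t (1 : ℝ))
    rw [h1, one_pow] at h2
    exact h2
  refine ⟨hγ.isOpen, hpolar.smooth.comp_contMDiffOn hγ.smooth, fun t ht => (hmem t ht).2, hunit,
    ?_, ?_⟩
  · intro t ht ξ
    refine hpolar.orthogonal (γ t) (hmem t ht) _ ?_ _
      ((mem_orbitTangentSpace_iff (ι (γ t)) _).2 ⟨ξ, rfl⟩)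
    rw [hvel t ht]
    exact ⟨_, rfl⟩
  · intro t ht v
    have h1 := (hpolar.isCompl (γ t) (hmem t ht)).sup_eq_top
    have h2 : (v : TangentSpace I (ι (γ t))) ∈
        LinearMap.range (mfderiv IS I ι (γ t)).toLinearMap ⊔
          orbitTangentSpace 𝓘(ℝ, EG) G I (ι (γ t)) := by
      rw [h1]
      trivial
    obtain ⟨a, ⟨ζ, hζ⟩, b, hb, hab⟩ :=
      (Submodule.mem_sup (M := TangentSpace I (ι (γ t)))).1 h2
    obtain ⟨ξ, hξ⟩ := (mem_orbitTangentSpace_iff (ι (γ t)) b).1 hb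
    -- the tangent space of the section is one-dimensional, hence spanned by the velocity
    set ζ₀ : EuclideanSpace ℝ (Fin 1) := modelDeriv 𝓘(ℝ, ℝ) IS γ t 1 with hζ₀
    have hζ₀0 : ζ₀ 0 ≠ 0 := by
      intro h
      have h3 : ζ₀ = 0 := by
        ext i
        rw [Subsingleton.elim i 0, h]
        rfl
      have h4 := hunit t ht
      rw [hvel t ht, ← hζ₀, h3, map_zero, map_zero] at h4
      simp at h4
    set ζ' : EuclideanSpace ℝ (Fin 1) := ζ with hζ'
    have hsmul : ζ' = (ζ' 0 / ζ₀ 0) • ζ₀ := by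
      ext i
      rw [Subsingleton.elim i 0]
      simp [hζ₀0]
    refine ⟨ζ' 0 / ζ₀ 0, ξ, ?_⟩
    have h5 : modelDeriv IS I ι (γ t) ζ' = a := hζ
    rw [hvel t ht, ← hζ₀, ← map_smul, ← hsmul, h5, hξ]
    exact hab.symm

end Section

theorem mainTheorem3
    {m : ℕ}
    -- the Riemannian manifold `M`, of dimension `m + 1`, possibly with boundary
    {H : Type*} [TopologicalSpace H]
    (I : ModelWithCorners ℝ (EuclideanSpace ℝ (Fin (m + 1))) H)
    {M : Type*} [TopologicalSpace M] [ChartedSpace H M] [IsManifold I ∞ M]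
    [ConnectedSpace M] [ParacompactSpace M] [T2Space M]
    [RiemannianBundle (fun x : M => TangentSpace I x)]
    [IsContMDiffRiemannianBundle I ∞ (EuclideanSpace ℝ (Fin (m + 1)))
      (fun x : M => TangentSpace I x)]
    -- the unimodular Lie group `G`, acting on `M`
    {EG : Type*} [NormedAddCommGroup EG] [NormedSpace ℝ EG] [FiniteDimensional ℝ EG]
    {G : Type*} [TopologicalSpace G] [ChartedSpace EG G] [Group G] [LieGroup 𝓘(ℝ, EG) ∞ G]
    [T2Space G] [SecondCountableTopology G] [MeasurableSpace G] [BorelSpace G]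
    (hG : IsUnimodularGroup G)
    [MulAction G M]
    -- the one-dimensional section of the polar action
    {HS : Type*} [TopologicalSpace HS]
    (IS : ModelWithCorners ℝ (EuclideanSpace ℝ (Fin 1)) HS)
    {S : Type*} [TopologicalSpace S] [ChartedSpace HS S]
    (ι : S → M)
    (hpolar : IsPolarSection 𝓘(ℝ, EG) G I IS ι)
    (hreg : IsRegularSection G I IS m ι)
    -- the arclength parametrization of `Σ`, and the change of variables onto `ℝ`
    (γ : ℝ → S) (D : Set ℝ)
    (hγ : IsArclengthParametrization G I IS ι γ D)
    (r₀ : ℝ) (hr₀ : r₀ ∈ D)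
    (hJ : IsC2Diffeo (arclengthChange G I m ι γ r₀) D Set.univ)
    -- the nonlinearity
    (f : M → ℝ → ℝ)
    (hf_cont : Continuous (Function.uncurry f))
    (hf_radial : ∀ (g : G) (x : M) (y : ℝ), f (g • x) y = f x y)
    (hf_nonneg : ∀ (x : M) (y : ℝ), 0 ≤ f x y) :
    (∀ u : M → ℝ, IsMaximalRadialSolution G I f u →
      (∀ x ∈ nonFixedInterior G I M, 0 ≤ u x) →
      ∃ c : ℝ, ∀ x ∈ nonFixedInterior G I M, u x = c) ∧
    ((∀ (x : M) (y : ℝ), 0 < f x y) →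
      ¬ ∃ u : M → ℝ, IsMaximalRadialSolution G I f u ∧
        ∀ x ∈ nonFixedInterior G I M, 0 ≤ u x) := by
  have hconst : ∀ u : M → ℝ, IsMaximalRadialSolution G I f u →
      (∀ x ∈ nonFixedInterior G I M, 0 ≤ u x) →
      ∃ c : ℝ, ∀ x ∈ nonFixedInterior G I M, u x = c := by
    intro u hu hu0
    have hc := hpolar.isNormalCurve hγ
    have hmem : ∀ t ∈ D, γ t ∈ regularPart G I ι := fun t ht => hγ.bijOn.mapsTo ht
    have hM₀ : ∀ t ∈ D, ι (γ t) ∈ nonFixedInterior G I M := hmem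
    set A : ℝ → ℝ := fun t => (orbitVolume G I m (ι (γ t))).toReal with hA
    set w : ℝ → ℝ := fun t => u (ι (γ t)) with hw
    have hApos : ∀ t ∈ D, 0 < A t := fun t ht =>
      ENNReal.toReal_pos (hreg.volume_pos _ (hmem t ht)).ne' (hreg.volume_lt_top _ (hmem t ht)).ne
    have hAs : ContDiffOn ℝ ∞ A D :=
      (hreg.volume_smooth.comp hγ.smooth fun t ht => hmem t ht).contDiffOn
    have hws : ContDiffOn ℝ 2 w D :=
      (hu.contMDiffOn.comp (hc.smooth.of_le ENat.LEInfty.out) hM₀).contDiffOn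
    have hD : IsOpen D := hγ.isOpen
    have hwd : ∀ t ∈ D, DifferentiableAt ℝ w t := fun t ht =>
      (hws.contDiffAt (hD.mem_nhds ht)).differentiableAt (by norm_num)
    have hJd : ∀ t ∈ D, HasDerivAt (arclengthChange G I m ι γ r₀) (A t)⁻¹ t := by
      intro t ht
      have hcont : ContinuousOn (fun t => (A t)⁻¹) D :=
        hAs.continuousOn.inv₀ fun t ht => (hApos t ht).ne'
      exact intervalIntegral.integral_hasDerivAt_right
        ((hcont.mono (hγ.ordConnected.uIcc_subset hr₀ ht)).intervalIntegrable)
        (hcont.stronglyMeasurableAtFilter hD t ht) (hcont.continuousAt (hD.mem_nhds ht))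
    have hPd : ∀ t ∈ D, DifferentiableAt ℝ (fun s => A s * deriv w s) t := by
      intro t ht
      have h1 := ((hws.contDiffAt (hD.mem_nhds ht)).fderiv_right (m := 1)
        (by norm_num)).differentiableAt (by norm_num)
      have h2 : DifferentiableAt ℝ (deriv w) t := h1.clm_apply (differentiableAt_const 1)
      exact ((hAs.contDiffAt (hD.mem_nhds ht)).differentiableAt (by simp)).mul h2
    have hP' : ∀ t ∈ D, deriv w t ≠ 0 → deriv (fun s => A s * deriv w s) t ≤ 0 := by
      intro t ht hne
      have h1 := hasDerivAt_orbitVolume_mul_deriv hpolar.isometricAction hc hws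
        (fun g t ht => hu.radial g _ (hM₀ t ht)) ht hne
      have h2 := hu.solves _ (hM₀ t ht)
      rw [h1.deriv, eq_neg_of_add_eq_zero_left h2, mul_neg]
      exact neg_nonpos.2 (mul_nonneg ENNReal.toReal_nonneg (hf_nonneg _ _))
    have hanti := antitoneOn_flux hD hγ.ordConnected hPd hP'
    have hzero : ∀ t ∈ D, deriv w t = 0 := fun t ht =>
      deriv_eq_zero_of_antitoneOn_flux hγ.ordConnected hApos hwd (fun t ht => hu0 _ (hM₀ t ht))
        hJd hJ.bijOn.surjOn hanti ht
    refine ⟨w r₀, fun x hx => ?_⟩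
    obtain ⟨g, s, hs, rfl⟩ := hreg.sweep x hx
    obtain ⟨t, ht, rfl⟩ := hγ.bijOn.surjOn hs
    rw [hu.radial g _ hs]
    exact hD.is_const_of_deriv_eq_zero hγ.ordConnected.isPreconnected
      (fun t ht => (hwd t ht).differentiableWithinAt) hzero ht hr₀
  refine ⟨hconst, ?_⟩
  rintro hfpos ⟨u, hu, hu0⟩
  obtain ⟨c, hc⟩ := hconst u hu hu0
  have hx : ι (γ r₀) ∈ nonFixedInterior G I M := hγ.bijOn.mapsTo hr₀
  have h1 : laplaceBeltrami I u (ι (γ r₀)) = 0 :=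
    laplaceBeltrami_eq_zero_of_eventually_const hx.2
      (Filter.eventually_of_mem (hreg.isOpen_nonFixedInterior.mem_nhds hx) hc)
  have h2 := hu.solves _ hx
  rw [h1, zero_add] at h2
  exact (hfpos _ _).ne' h2
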